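/- For a finite poset $P$ and a family $\mathcal{F}$ of subsets of $[n]=\{1,\dots,n\}$, ordered by inclusion, say that $\mathcal{F}$ is $P$-free if it does not contain $P$ as an induced subposet. For nonempty $P$, let $\mathrm{La}^*(n,P)$ be the maximum size of a $P$-free family of subsets of $[n]$, and let $\pi^*(P)=\limsup_{n\to\infty}\mathrm{La}^*(n,P)/\binom{n}{\lfloor n/2\rfloor}$. For $r\ge 1$, the standard example $S_r$ is the poset on the $2r$ elements $a_1,\dots,a_r,b_1,\dots,b_r$ whose only relations between distinct elements are $b_j\le a_i$ for $i\ne j$. Theorem. For every integer $r\ge 1$, the limit superior $\pi^*(S_r)$ is finite and $$r-2\;\le\;\pi^*(S_r)\;\le\; r+2\sqrt{r}+6 .$$ Moreover, $\mathrm{La}^*(n,S_r)=(r+O(\sqrt r))\binom{n}{\lfloor n/2\rfloor}$ for large $n$: there is an absolute constant $C$ such that for every integer $r\ge 1$ and all sufficiently large $n$ (depending on $r$), $$\left|\mathrm{La}^*(n,S_r)-r\binom{n}{\lfloor n/2\rfloor}\right|\le C\sqrt{r}\,\binom{n}{\lfloor n/2\rfloor}.$$ -/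

import Mathlib

/-- The elements of the standard example on `2r` elements: `a i` and `b i` for `i : Fin r`. -/
inductive StandardExample (r : ℕ) : Type
  | a (i : Fin r) : StandardExample r
  | b (i : Fin r) : StandardExample r

namespace StandardExample

/-- The `a i` form an antichain, the `b i` form an antichain, `b j ≤ a i` if and only if `i ≠ j`,
and no `a i` lies below a `b j`. -/
protected def le {r : ℕ} : StandardExample r → StandardExample r → Prop
  | a i, a j => i = j
  | b i, b j => i = j
  | b j, a i => i ≠ j
  | a _, b _ => False

instance instPartialOrder (r : ℕ) : PartialOrder (StandardExample r) where
  le := StandardExample.le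
  le_refl x := by cases x <;> simp [StandardExample.le]
  le_trans x y z hxy hyz := by
    cases x <;> cases y <;> cases z <;> simp_all [StandardExample.le]
  le_antisymm x y hxy hyx := by
    cases x <;> cases y <;> simp_all [StandardExample.le]

end StandardExample

/-- A family `F` of subsets of an `n`-element set is `P`-free if `F`, ordered by inclusion, does not
contain `P` as an induced subposet. -/
def PosetFree (P : Type*) [PartialOrder P] {n : ℕ} (F : Finset (Finset (Fin n))) : Prop :=
  ¬ Nonempty (P ↪o {A : Finset (Fin n) // A ∈ F})

open Classical in
/-- The (induced) Turán function: the maximum size of a `P`-free family of subsets of an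
`n`-element set (for nonempty `P`, the empty family is `P`-free, so the maximum exists). -/
noncomputable def turanFunction (n : ℕ) (P : Type*) [PartialOrder P] : ℕ :=
  (Finset.univ.filter fun F : Finset (Finset (Fin n)) => PosetFree P F).sup Finset.card

/-- The Turán threshold: the limit superior, as `n → ∞`, of the Turán function divided by the
central binomial coefficient. It takes values in the extended reals, so that it is finite exactly
when the limit superior is. -/
noncomputable def turanThreshold (P : Type*) [PartialOrder P] : EReal :=
  Filter.limsup
    (fun n : ℕ => (((turanFunction n P : ℝ) / (n.choose (n / 2) : ℝ) : ℝ) : EReal)) Filter.atTop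

/-! The Lubell mass of a family is the expected number of its members on a uniformly random maximal
chain, and a family in the cube has size at most its Lubell mass times the middle binomial
coefficient. Sets far from the middle levels are negligible by a Chernoff bound. So the upper bound
reduces to showing that a family on the levels near n/2 without a crown of size R has mass at most R
+ o(1).

Call a set rich if members of F lie above it and their intersection is the set itself. Let D and T
be the sets of a chain at levels k and k + r. If for each x in T \ D some member contains T \ {x}
but not x, and some member inside D ∪ {x} contains x, these members form a crown. Hence a chain that
stays rich, both from below and (for complements) from above, meets F in at most r levels unless
some x is obstructed (`hits_le`). Both failures are rare. Where a set is not rich, all members above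
it share a further element, which costs a factor δ of about (number of levels)/n. An obstruction
means that an unlikely element was chosen next. The resulting bound `lubell_le_of_not_hasCrown` has
error of order δ(H + r²), where H bounds the masses of links.

The middle strip is wider than √n, so bounding H by the number of levels is too weak. The estimate
is therefore applied first to narrow windows inside the links, and the improved H is fed back
(`lubell_middle_le`). This gives R + o(1) in `eventually_card_le`.

An S_r-free family has no crown of size r + 2, so the upper bound obtained is r + 2 + o(1), stronger
than needed. For the lower bound, r - 2 consecutive full levels contain no S_r. -/

/-! ### Maximal chains as enumerations of the ground set -/

section Chains

open Finset

variable {α : Type*} [Fintype α]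

/-- The set of the first `t` elements in the enumeration `σ`. -/
def initSeg (σ : α ≃ Fin (Fintype.card α)) (t : ℕ) : Finset α :=
  univ.filter fun x => (σ x : ℕ) < t

@[simp] lemma mem_initSeg {σ : α ≃ Fin (Fintype.card α)} {t : ℕ} {x : α} :
    x ∈ initSeg σ t ↔ (σ x : ℕ) < t := by
  simp [initSeg]

lemma initSeg_mono (σ : α ≃ Fin (Fintype.card α)) {s t : ℕ} (h : s ≤ t) :
    initSeg σ s ⊆ initSeg σ t := by
  intro x hx
  rw [mem_initSeg] at *
  omega

lemma card_initSeg (σ : α ≃ Fin (Fintype.card α)) {t : ℕ} (ht : t ≤ Fintype.card α) :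
    (initSeg σ t).card = t := by
  have h : (initSeg σ t).map σ.toEmbedding =
      univ.filter fun i : Fin (Fintype.card α) => (i : ℕ) < t := by
    ext i
    simp only [mem_map, mem_initSeg, Equiv.coe_toEmbedding, mem_filter, mem_univ, true_and]
    constructor
    · rintro ⟨x, hx, rfl⟩
      exact hx
    · intro hi
      exact ⟨σ.symm i, by simpa using hi, by simp⟩
  rw [← card_map σ.toEmbedding, h, Fin.card_filter_val_lt]
  omega

lemma initSeg_swap (σ : α ≃ Fin (Fintype.card α)) {i j : Fin (Fintype.card α)} {t : ℕ}
    (hi : t ≤ i) (hj : t ≤ j) : initSeg (σ.trans (Equiv.swap i j)) t = initSeg σ t := by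
  ext x
  simp only [mem_initSeg, Equiv.trans_apply]
  rcases eq_or_ne (σ x) i with h | h
  · rw [h, Equiv.swap_apply_left]; omega
  rcases eq_or_ne (σ x) j with h' | h'
  · rw [h', Equiv.swap_apply_right]; omega
  rw [Equiv.swap_apply_of_ne_of_ne h h']

lemma initSeg_swap_of_lt (σ : α ≃ Fin (Fintype.card α)) {i j : Fin (Fintype.card α)} {t : ℕ}
    (hi : (i : ℕ) < t) (hj : (j : ℕ) < t) :
    initSeg (σ.trans (Equiv.swap i j)) t = initSeg σ t := by
  ext x
  simp only [mem_initSeg, Equiv.trans_apply]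
  rcases eq_or_ne (σ x) i with h | h
  · rw [h, Equiv.swap_apply_left]; omega
  rcases eq_or_ne (σ x) j with h' | h'
  · rw [h', Equiv.swap_apply_right]; omega
  rw [Equiv.swap_apply_of_ne_of_ne h h']

variable [DecidableEq α]

lemma initSeg_succ (σ : α ≃ Fin (Fintype.card α)) {s : ℕ} (hs : s < Fintype.card α) :
    initSeg σ (s + 1) = insert (σ.symm ⟨s, hs⟩) (initSeg σ s) := by
  ext x
  simp only [mem_initSeg, mem_insert, Equiv.eq_symm_apply, Fin.ext_iff]
  omega

lemma initSeg_rev (σ : α ≃ Fin (Fintype.card α)) {t : ℕ} (ht : t ≤ Fintype.card α) :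
    initSeg (σ.trans Fin.revPerm) (Fintype.card α - t) = (initSeg σ t)ᶜ := by
  ext x
  have := (σ x).isLt
  simp only [mem_initSeg, Equiv.trans_apply, Fin.revPerm_apply, Fin.val_rev, mem_compl]
  omega

/-- `w` depends only on the first `s` members of the chain given by an enumeration. -/
def AdaptedTo {β : Type*} (s : ℕ) (w : (α ≃ Fin (Fintype.card α)) → β) : Prop :=
  ∀ σ σ', (∀ t ≤ s, initSeg σ t = initSeg σ' t) → w σ = w σ'

/-- Conditionally on the first `s` entries of an enumeration, the next one is uniform. -/
lemma sum_next_eq {s : ℕ} (hs : s < Fintype.card α)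
    (G : (α ≃ Fin (Fintype.card α)) → α → ℝ) (hG : AdaptedTo s G) :
    ((Fintype.card α : ℝ) - s) * ∑ σ : α ≃ Fin (Fintype.card α), G σ (σ.symm ⟨s, hs⟩) =
      ∑ σ : α ≃ Fin (Fintype.card α), ∑ y ∈ (initSeg σ s)ᶜ, G σ y := by
  have h1 : ∀ σ : α ≃ Fin (Fintype.card α), ∑ y ∈ (initSeg σ s)ᶜ, G σ y =
      ∑ u ∈ univ.filter (fun u : Fin (Fintype.card α) => s ≤ (u : ℕ)), G σ (σ.symm u) := by
    intro σ
    refine sum_bij' (fun y _ => σ y) (fun u _ => σ.symm u) ?_ ?_ ?_ ?_ ?_ <;> simp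
  simp_rw [h1]
  rw [sum_comm]
  -- Exchanging positions s and u fixes the first s entries, hence G, and moves the entry at u to
  -- position s. So all positions from s on contribute equally.
  have h2 : ∀ u ∈ univ.filter (fun u : Fin (Fintype.card α) => s ≤ (u : ℕ)),
      ∑ σ : α ≃ Fin (Fintype.card α), G σ (σ.symm u) =
        ∑ σ : α ≃ Fin (Fintype.card α), G σ (σ.symm ⟨s, hs⟩) := by
    intro u hu
    have hu' : s ≤ (u : ℕ) := by simpa using hu
    refine sum_nbij' (fun σ => σ.trans (Equiv.swap ⟨s, hs⟩ u))
      (fun σ => σ.trans (Equiv.swap ⟨s, hs⟩ u)) (by simp) (by simp) ?_ ?_ ?_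
    · intro σ _; ext x; simp
    · intro σ _; ext x; simp
    · intro σ _
      have : G (σ.trans (Equiv.swap ⟨s, hs⟩ u)) = G σ :=
        hG _ _ fun t ht => initSeg_swap σ (by simpa using ht) (ht.trans hu')
      rw [this]
      simp
  rw [sum_congr rfl h2, sum_const, nsmul_eq_mul]
  congr 1
  have : (univ.filter (fun u : Fin (Fintype.card α) => s ≤ (u : ℕ))).card =
      Fintype.card α - s := by
    have h := card_filter_add_card_filter_not (s := univ)
      (fun u : Fin (Fintype.card α) => (u : ℕ) < s)
    rw [Fin.card_filter_val_lt, card_univ, Fintype.card_fin] at h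
    simp only [not_lt] at h
    omega
  rw [this, Nat.cast_sub hs.le]

/-- The Lubell mass of the members of `F` above `S`, in the cube of all sets above `S`. -/
noncomputable def upLubell (F : Finset (Finset α)) (S : Finset α) : ℝ :=
  ∑ B ∈ F.filter (S ⊆ ·), ((Fintype.card α - S.card).choose (B.card - S.card) : ℝ)⁻¹

/-- The Lubell mass of `F`. -/
noncomputable def lubell (F : Finset (Finset α)) : ℝ :=
  ∑ B ∈ F, ((Fintype.card α).choose B.card : ℝ)⁻¹

lemma upLubell_empty (F : Finset (Finset α)) : upLubell F ∅ = lubell F := by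
  simp [upLubell, lubell]

lemma inv_choose_succ {n k : ℕ} (hk : k ≤ n) :
    ((n + 1).choose (k + 1) : ℝ)⁻¹ = ((k : ℝ) + 1) / (n + 1) * (n.choose k : ℝ)⁻¹ := by
  have h := Nat.add_one_mul_choose_eq n k
  have h' : ((n : ℝ) + 1) * n.choose k = (n + 1).choose (k + 1) * (k + 1) := by exact_mod_cast h
  have h1 : (n.choose k : ℝ) ≠ 0 := by exact_mod_cast (Nat.choose_pos hk).ne'
  have h2 : ((n + 1).choose (k + 1) : ℝ) ≠ 0 := by
    exact_mod_cast (Nat.choose_pos (Nat.succ_le_succ hk)).ne'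
  have h3 : (n : ℝ) + 1 ≠ 0 := by positivity
  field_simp
  linarith

/-- The weight of a proper superset `B` of `S`, seen from `S` and from a set one larger. -/
lemma inv_choose_step {n s b : ℕ} (hs : s < b) (hb : b ≤ n) :
    ((n - s).choose (b - s) : ℝ)⁻¹ =
      ((b : ℝ) - s) / (n - s) * ((n - (s + 1)).choose (b - (s + 1)) : ℝ)⁻¹ := by
  obtain ⟨k, rfl⟩ : ∃ k, b = s + 1 + k := ⟨b - (s + 1), by omega⟩
  obtain ⟨m, rfl⟩ : ∃ m, n = s + 1 + m := ⟨n - (s + 1), by omega⟩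
  have e1 : s + 1 + m - s = m + 1 := by omega
  have e2 : s + 1 + k - s = k + 1 := by omega
  rw [e1, e2, Nat.add_sub_cancel_left, Nat.add_sub_cancel_left, inv_choose_succ (by omega)]
  push_cast
  congr 2 <;> ring

lemma upLubell_univ (F : Finset (Finset α)) :
    upLubell F univ = if univ ∈ F then 1 else 0 := by
  have : F.filter (univ ⊆ ·) = if univ ∈ F then {univ} else ∅ := by
    ext B
    split_ifs with h <;> simp only [mem_filter, univ_subset_iff, mem_singleton, notMem_empty]
    · exact ⟨fun h => h.2, fun h' => ⟨h' ▸ h, h'⟩⟩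
    · simp only [iff_false]; rintro ⟨h1, rfl⟩; exact h h1
  rw [upLubell, this]
  split_ifs <;> simp

/-- One-step recursion for expected hits: a random chain going up from S counts S and then moves to
a uniformly chosen one-point extension. -/
lemma upLubell_step (F : Finset (Finset α)) {S : Finset α} (hS : S.card < Fintype.card α) :
    upLubell F S = (if S ∈ F then 1 else 0) +
      ((Fintype.card α : ℝ) - S.card)⁻¹ * ∑ y ∈ Sᶜ, upLubell F (insert y S) := by
  have hpos : (0 : ℝ) < (Fintype.card α : ℝ) - S.card := by
    rw [sub_pos]; exact_mod_cast hS
  have hsplit : upLubell F S = (if S ∈ F then 1 else 0) +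
      ∑ B ∈ F.filter (S ⊂ ·), ((Fintype.card α - S.card).choose (B.card - S.card) : ℝ)⁻¹ := by
    have : F.filter (S ⊆ ·) = F.filter (· = S) ∪ F.filter (S ⊂ ·) := by
      ext B
      simp only [mem_filter, mem_union, ← and_or_left]
      rw [subset_iff_ssubset_or_eq, or_comm, eq_comm]
    rw [upLubell, this, sum_union]
    · congr 1
      rw [filter_eq']
      split_ifs <;> simp
    · rw [disjoint_filter]
      rintro B - rfl h
      exact ssubset_irrefl _ h
  rw [hsplit]
  congr 1
  -- Each B strictly above S is reached through |B \ S| choices of y, which is the numerator in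
  -- `inv_choose_step`.
  have hcomm : ∑ y ∈ Sᶜ, upLubell F (insert y S) =
      ∑ B ∈ F.filter (S ⊂ ·), ∑ y ∈ B \ S,
        ((Fintype.card α - (S.card + 1)).choose (B.card - (S.card + 1)) : ℝ)⁻¹ := by
    have : ∀ y ∈ Sᶜ, upLubell F (insert y S) = ∑ B ∈ F.filter (insert y S ⊆ ·),
        ((Fintype.card α - (S.card + 1)).choose (B.card - (S.card + 1)) : ℝ)⁻¹ := by
      intro y hy
      rw [upLubell, card_insert_of_notMem (by simpa using hy)]
    rw [sum_congr rfl this]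
    refine sum_comm' ?_
    intro y B
    simp only [mem_compl, mem_filter, insert_subset_iff, mem_sdiff, ssubset_iff_subset_ne]
    constructor
    · rintro ⟨h1, h2, h3, h4⟩
      exact ⟨⟨h3, h1⟩, h2, h4, fun h => h1 (h ▸ h3)⟩
    · rintro ⟨⟨h1, h2⟩, h3, h4, -⟩
      exact ⟨h2, h3, h1, h4⟩
  rw [hcomm, mul_sum]
  refine sum_congr rfl fun B hB => ?_
  have hB' := (mem_filter.mp hB).2
  rw [sum_const, card_sdiff_of_subset hB'.1, nsmul_eq_mul, Nat.cast_sub (card_le_card hB'.1),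
    inv_choose_step (card_lt_card hB') (card_le_univ B)]
  field_simp

/-- Conditionally on the first `s` entries, the expected number of members of `F` on the chain
from level `s` on is the Lubell mass above the current set. -/
lemma sum_hits_eq (F : Finset (Finset α)) {s : ℕ} (hs : s ≤ Fintype.card α)
    (w : (α ≃ Fin (Fintype.card α)) → ℝ) (hw : AdaptedTo s w) :
    ∑ σ, w σ * ∑ k ∈ Icc s (Fintype.card α), (if initSeg σ k ∈ F then (1 : ℝ) else 0) =
      ∑ σ, w σ * upLubell F (initSeg σ s) := by
  -- Descending induction from the full set: a weight adapted to level s is adapted to s + 1, and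
  -- `sum_next_eq` averages over the entry in between.
  induction hs using Nat.decreasingInduction generalizing w with
  | self =>
    refine sum_congr rfl fun σ _ => ?_
    have : initSeg σ (Fintype.card α) = univ := by ext x; simp
    rw [Icc_self, sum_singleton, this, upLubell_univ]
  | of_succ s hs ih =>
    have hw' : AdaptedTo (s + 1) w := fun σ σ' h => hw σ σ' fun t ht => h t (by omega)
    have hpos : (0 : ℝ) < (Fintype.card α : ℝ) - s := by
      rw [sub_pos]; exact_mod_cast hs
    have h1 := ih w hw'
    have h2 := sum_next_eq hs (fun σ y => w σ * upLubell F (insert y (initSeg σ s))) (by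
      intro σ σ' h
      funext y
      simp only [hw σ σ' h, h s le_rfl])
    have hI : Icc s (Fintype.card α) = insert s (Icc (s + 1) (Fintype.card α)) := by
      ext k; simp only [mem_Icc, mem_insert]; omega
    have hsum : ∀ σ : α ≃ Fin (Fintype.card α),
        ∑ k ∈ Icc s (Fintype.card α), (if initSeg σ k ∈ F then (1 : ℝ) else 0) =
          (if initSeg σ s ∈ F then (1 : ℝ) else 0) +
          ∑ k ∈ Icc (s + 1) (Fintype.card α), (if initSeg σ k ∈ F then (1 : ℝ) else 0) := by
      intro σ
      rw [hI, sum_insert (by simp)]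
    simp_rw [hsum, mul_add, sum_add_distrib]
    rw [h1]
    simp_rw [← mul_sum] at h2
    rw [mul_comm, ← eq_div_iff hpos.ne'] at h2
    simp_rw [initSeg_succ _ hs]
    rw [h2, sum_div, ← sum_add_distrib]
    refine sum_congr rfl fun σ _ => ?_
    rw [upLubell_step F (by rw [card_initSeg σ hs.le]; exact hs), card_initSeg σ hs.le]
    ring

end Chains

/-! ### Crowns and forced elements -/

set_option linter.unusedSectionVars false

section Crowns

open Finset

variable {α : Type*}

/-- `F` contains sets `a i`, `b i` for `i : Fin r` with `b j ⊆ a i` exactly when `i ≠ j`. -/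
def HasCrown (r : ℕ) (F : Finset (Finset α)) : Prop :=
  ∃ a b : Fin r → Finset α, (∀ i, a i ∈ F) ∧ (∀ i, b i ∈ F) ∧ ∀ i j, b j ⊆ a i ↔ i ≠ j

lemma HasCrown.mono {r : ℕ} {F G : Finset (Finset α)} (h : HasCrown r F) (hFG : F ⊆ G) :
    HasCrown r G := by
  obtain ⟨a, b, ha, hb, hab⟩ := h
  exact ⟨a, b, fun i => hFG (ha i), fun i => hFG (hb i), hab⟩

variable [Fintype α] [DecidableEq α]

/-- The family of complements. -/
def complFamily (F : Finset (Finset α)) : Finset (Finset α) := F.image (·ᶜ)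

@[simp] lemma mem_complFamily {F : Finset (Finset α)} {A : Finset α} :
    A ∈ complFamily F ↔ Aᶜ ∈ F := by
  simp only [complFamily, mem_image]
  constructor
  · rintro ⟨B, hB, rfl⟩
    simpa using hB
  · intro h
    exact ⟨Aᶜ, h, compl_compl A⟩

lemma HasCrown.complFamily {r : ℕ} {F : Finset (Finset α)} (h : HasCrown r (complFamily F)) :
    HasCrown r F := by
  obtain ⟨a, b, ha, hb, hab⟩ := h
  refine ⟨fun i => (b i)ᶜ, fun i => (a i)ᶜ, fun i => ?_, fun i => ?_, fun i j => ?_⟩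
  · simpa using hb i
  · simpa using ha i
  · rw [compl_subset_compl, hab, ne_comm]

/-- Some member of `F` contains `S`, and for each `x ∉ S` such a member can be chosen to
avoid `x`. -/
def UpRich (F : Finset (Finset α)) (S : Finset α) : Prop :=
  (∃ a ∈ F, S ⊆ a) ∧ ∀ x ∉ S, ∃ a ∈ F, S ⊆ a ∧ x ∉ a

/-- The elements outside `S` that lie in all members of `F` above `S`, provided there are such
members. -/
def forced (F : Finset (Finset α)) (S : Finset α) : Finset α :=
  univ.filter fun x => x ∉ S ∧ (∃ a ∈ F, S ⊆ a) ∧ ∀ a ∈ F, S ⊆ a → x ∈ a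

lemma not_upRich_of_mem_forced {F : Finset (Finset α)} {S : Finset α} {x : α}
    (hx : x ∈ forced F S) : ¬ UpRich F S := by
  rintro ⟨-, h⟩
  simp only [forced, mem_filter, mem_univ, true_and] at hx
  obtain ⟨a, ha, hSa, hxa⟩ := h x hx.1
  exact hxa (hx.2.2 a ha hSa)

/-- All forced elements lie in any one member above S, and that member has at most `hi` elements.
The existence clause in `forced` makes the set empty when nothing lies above S. -/
lemma card_forced_le {F : Finset (Finset α)} {S : Finset α} {hi : ℕ}
    (hF : ∀ B ∈ F, B.card ≤ hi) (hS : S.card ≤ hi) : ((forced F S).card : ℝ) ≤ hi - S.card := by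
  by_cases h : ∃ a ∈ F, S ⊆ a
  · obtain ⟨a, ha, hSa⟩ := h
    have hsub : forced F S ⊆ a \ S := by
      intro x hx
      simp only [forced, mem_filter, mem_univ, true_and] at hx
      exact mem_sdiff.2 ⟨hx.2.2 a ha hSa, hx.1⟩
    have h1 := card_le_card hsub
    rw [card_sdiff_of_subset hSa] at h1
    have h2 := hF a ha
    have h3 := card_le_card hSa
    have : (forced F S).card + S.card ≤ hi := by omega
    have : ((forced F S).card : ℝ) + S.card ≤ hi := by exact_mod_cast this
    linarith
  · have : forced F S = ∅ := by
      rw [forced, filter_eq_empty_iff]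
      rintro x - ⟨-, h', -⟩
      exact h h'
    rw [this, card_empty, Nat.cast_zero, sub_nonneg]
    exact_mod_cast hS

/-- Supplies the uniform δ that bounds both the weight ratio in `inv_choose_step` and the fraction
of forced elements. -/
lemma div_sub_le_div_sub {n lo hi s b : ℕ} (hs : lo ≤ s) (hsh : s ≤ hi) (hb : b ≤ hi)
    (hn : hi < n) : ((b : ℝ) - s) / (n - s) ≤ ((hi : ℝ) - lo) / (n - lo) := by
  have h1 : (lo : ℝ) ≤ s := by exact_mod_cast hs
  have h2 : (s : ℝ) ≤ hi := by exact_mod_cast hsh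
  have h3 : (b : ℝ) ≤ hi := by exact_mod_cast hb
  have h4 : (hi : ℝ) < n := by exact_mod_cast hn
  rw [div_le_div_iff₀ (by linarith) (by linarith)]
  nlinarith [mul_nonneg (sub_nonneg.2 h1) (sub_nonneg.2 h4.le),
    mul_nonneg (sub_nonneg.2 h3) (by linarith : (0 : ℝ) ≤ n - lo)]

/-- If members lie above S, failure of richness gives a common x ∉ S, so the members above S are
those above `insert x S`. Passing to that set changes each weight by a factor of at most δ. -/
lemma upLubell_le_of_not_upRich {F : Finset (Finset α)} {lo hi : ℕ} {H : ℝ}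
    (hF : ∀ B ∈ F, B.card ≤ hi) (hn : hi < Fintype.card α) (hH0 : 0 ≤ H)
    (hH : ∀ A : Finset α, lo ≤ A.card → A.card ≤ hi → upLubell F A ≤ H)
    {S : Finset α} (hlo : lo ≤ S.card) (hhi : S.card ≤ hi) (hS : ¬ UpRich F S) :
    upLubell F S ≤ ((hi : ℝ) - lo) / (Fintype.card α - lo) * H := by
  have h1 : (lo : ℝ) ≤ S.card := by exact_mod_cast hlo
  have h2 : (S.card : ℝ) ≤ hi := by exact_mod_cast hhi
  have h4 : (hi : ℝ) < Fintype.card α := by exact_mod_cast hn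
  have hδ : 0 ≤ ((hi : ℝ) - lo) / (Fintype.card α - lo) :=
    div_nonneg (by linarith) (by linarith)
  by_cases h : ∃ a ∈ F, S ⊆ a
  · obtain ⟨x, hxS, hx⟩ : ∃ x ∉ S, ∀ a ∈ F, S ⊆ a → x ∈ a := by
      by_contra! hcon
      exact hS ⟨h, hcon⟩
    have hfil : F.filter (S ⊆ ·) = F.filter (insert x S ⊆ ·) := by
      refine filter_congr fun B hB => ?_
      rw [insert_subset_iff]
      exact ⟨fun h => ⟨hx B hB h, h⟩, fun h => h.2⟩
    have hcard : (insert x S).card = S.card + 1 := card_insert_of_notMem hxS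
    have hle : upLubell F S ≤
        ((hi : ℝ) - lo) / (Fintype.card α - lo) * upLubell F (insert x S) := by
      rw [upLubell, upLubell, hfil, mul_sum]
      refine sum_le_sum fun B hB => ?_
      obtain ⟨hBF, hB⟩ := mem_filter.1 hB
      have := card_le_card hB
      rw [hcard] at this
      rw [inv_choose_step (by omega) (card_le_univ B), hcard]
      exact mul_le_mul_of_nonneg_right (div_sub_le_div_sub hlo hhi (hF B hBF) hn) (by positivity)
    obtain ⟨a, ha, hSa⟩ := h
    have h5 := card_le_card (insert_subset (hx a ha hSa) hSa)
    exact hle.trans (mul_le_mul_of_nonneg_left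
      (hH _ (by omega) (by have := hF a ha; omega)) hδ)
  · have : F.filter (S ⊆ ·) = ∅ := by
      rw [filter_eq_empty_iff]
      intro B hB hSB
      exact h ⟨B, hB, hSB⟩
    rw [upLubell, this, sum_empty]
    positivity

/-- All members of the chain of `σ` from level `lo` up to level `t` are rich. -/
def Alive (F : Finset (Finset α)) (lo : ℕ) (σ : α ≃ Fin (Fintype.card α)) (t : ℕ) : Prop :=
  ∀ s, lo ≤ s → s ≤ t → UpRich F (initSeg σ s)

lemma Alive.mono {F : Finset (Finset α)} {lo s t : ℕ} {σ : α ≃ Fin (Fintype.card α)}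
    (h : Alive F lo σ t) (hst : s ≤ t) : Alive F lo σ s :=
  fun u hu hus => h u hu (hus.trans hst)

lemma Alive.congr {F : Finset (Finset α)} {lo t : ℕ} {σ σ' : α ≃ Fin (Fintype.card α)}
    (h : ∀ s ≤ t, initSeg σ s = initSeg σ' s) : Alive F lo σ t ↔ Alive F lo σ' t := by
  refine forall_congr' fun s => forall_congr' fun _ => forall_congr' fun hs => ?_
  rw [h s hs]

/-- Level `s` is the first level from `lo` on at which the chain of `σ` is not rich. -/
def FirstExit (F : Finset (Finset α)) (lo : ℕ) (σ : α ≃ Fin (Fintype.card α)) (s : ℕ) : Prop :=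
  lo ≤ s ∧ (∀ u, lo ≤ u → u < s → UpRich F (initSeg σ u)) ∧ ¬ UpRich F (initSeg σ s)

lemma exists_firstExit {F : Finset (Finset α)} {lo t : ℕ} {σ : α ≃ Fin (Fintype.card α)}
    (h : ¬ Alive F lo σ t) : ∃ s ≤ t, FirstExit F lo σ s := by
  classical
  have hex : ∃ s, lo ≤ s ∧ ¬ UpRich F (initSeg σ s) := by
    simp only [Alive, not_forall] at h
    obtain ⟨s, h1, h2, h3⟩ := h
    exact ⟨s, h1, h3⟩
  have ht : Nat.find hex ≤ t := by
    simp only [Alive, not_forall] at h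
    obtain ⟨s, h1, h2, h3⟩ := h
    exact (Nat.find_min' hex ⟨h1, h3⟩).trans h2
  refine ⟨Nat.find hex, ht, (Nat.find_spec hex).1, fun u hu hlt => ?_, (Nat.find_spec hex).2⟩
  by_contra hcon
  exact Nat.find_min hex hlt ⟨hu, hcon⟩

lemma FirstExit.unique {F : Finset (Finset α)} {lo s t : ℕ} {σ : α ≃ Fin (Fintype.card α)}
    (hs : FirstExit F lo σ s) (ht : FirstExit F lo σ t) : s = t := by
  rcases lt_trichotomy s t with h | h | h
  · exact absurd (ht.2.1 s hs.1 h) hs.2.2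
  · exact h
  · exact absurd (hs.2.1 t ht.1 h) ht.2.2

lemma FirstExit.le_of_not_alive {F : Finset (Finset α)} {lo s t : ℕ}
    {σ : α ≃ Fin (Fintype.card α)} (hs : FirstExit F lo σ s) (ht : ¬ Alive F lo σ t) : s ≤ t := by
  obtain ⟨u, hu, hu'⟩ := exists_firstExit ht
  rwa [hs.unique hu']

open Classical in
/-- The expected number of members of `F` on a random chain after it has ceased to be rich. -/
lemma sum_hits_not_alive_le {F : Finset (Finset α)} {lo hi : ℕ} {H : ℝ}
    (hF : ∀ B ∈ F, B.card ≤ hi) (hlh : lo ≤ hi) (hn : hi < Fintype.card α) (hH0 : 0 ≤ H)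
    (hH : ∀ A : Finset α, lo ≤ A.card → A.card ≤ hi → upLubell F A ≤ H) :
    ∑ σ : α ≃ Fin (Fintype.card α), ∑ k ∈ Icc lo hi,
        (if initSeg σ k ∈ F ∧ ¬ Alive F lo σ k then (1 : ℝ) else 0) ≤
      Fintype.card (α ≃ Fin (Fintype.card α)) *
        (((hi : ℝ) - lo) / (Fintype.card α - lo) * H) := by
  set δ : ℝ := ((hi : ℝ) - lo) / (Fintype.card α - lo) with hδdef
  have hδ : 0 ≤ δ := by
    have h1 : (lo : ℝ) ≤ hi := by exact_mod_cast hlh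
    have h4 : (hi : ℝ) < Fintype.card α := by exact_mod_cast hn
    exact div_nonneg (by linarith) (by linarith)
  have hnn : ∀ (σ : α ≃ Fin (Fintype.card α)) (s : ℕ),
      0 ≤ (if FirstExit F lo σ s then (1 : ℝ) else 0) *
        ∑ k ∈ Icc s (Fintype.card α), (if initSeg σ k ∈ F then (1 : ℝ) else 0) := by
    intro σ s
    exact mul_nonneg (by split_ifs <;> simp) (sum_nonneg fun k _ => by split_ifs <;> simp)
  -- Every hit at a level where the chain is no longer alive occurs at or after its first exit
  -- level.
  have hpt : ∀ σ : α ≃ Fin (Fintype.card α), ∑ k ∈ Icc lo hi,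
      (if initSeg σ k ∈ F ∧ ¬ Alive F lo σ k then (1 : ℝ) else 0) ≤
      ∑ s ∈ Icc lo hi, (if FirstExit F lo σ s then (1 : ℝ) else 0) *
        ∑ k ∈ Icc s (Fintype.card α), (if initSeg σ k ∈ F then (1 : ℝ) else 0) := by
    intro σ
    by_cases hex : ∃ k ∈ Icc lo hi, ¬ Alive F lo σ k
    · obtain ⟨k, hk, hka⟩ := hex
      obtain ⟨s, hsk, hs⟩ := exists_firstExit hka
      have hsI : s ∈ Icc lo hi := mem_Icc.2 ⟨hs.1, hsk.trans (mem_Icc.1 hk).2⟩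
      refine le_trans ?_ (single_le_sum (fun s _ => hnn σ s) hsI)
      rw [if_pos hs, one_mul, ← sum_filter, ← sum_filter]
      refine sum_le_sum_of_subset_of_nonneg ?_ (fun _ _ _ => zero_le_one)
      intro k hk
      simp only [mem_filter, mem_Icc] at hk ⊢
      exact ⟨⟨hs.le_of_not_alive hk.2.2, by omega⟩, hk.2.1⟩
    · push Not at hex
      rw [sum_eq_zero]
      · exact sum_nonneg fun s _ => hnn σ s
      · intro k hk
        rw [if_neg]
        exact fun h => h.2 (hex k hk)
  -- A first exit at s is decided by the first s levels, so the later hits may be replaced by their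
  -- conditional expectation, which is small because the set at level s is not rich.
  have hexit : ∀ s ∈ Icc lo hi, ∑ σ : α ≃ Fin (Fintype.card α),
      (if FirstExit F lo σ s then (1 : ℝ) else 0) *
        ∑ k ∈ Icc s (Fintype.card α), (if initSeg σ k ∈ F then (1 : ℝ) else 0) ≤
      ∑ σ : α ≃ Fin (Fintype.card α), (if FirstExit F lo σ s then (1 : ℝ) else 0) * (δ * H) := by
    intro s hs
    rw [mem_Icc] at hs
    rw [sum_hits_eq F (by omega)]
    · refine sum_le_sum fun σ _ => ?_
      split_ifs with h
      · rw [one_mul, one_mul]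
        have hc := card_initSeg σ (t := s) (by omega)
        exact upLubell_le_of_not_upRich hF hn hH0 hH (by omega) (by omega) h.2.2
      · simp
    · intro σ σ' h
      have : FirstExit F lo σ s ↔ FirstExit F lo σ' s := by
        unfold FirstExit
        rw [h s le_rfl]
        refine and_congr_right fun _ => and_congr_left fun _ => ?_
        refine forall_congr' fun u => forall_congr' fun _ => forall_congr' fun hu => ?_
        rw [h u hu.le]
      simp only [this]
  calc _ ≤ _ := sum_le_sum fun σ _ => hpt σ
    _ = _ := sum_comm
    _ ≤ _ := sum_le_sum hexit
    _ = ∑ σ : α ≃ Fin (Fintype.card α),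
        (∑ s ∈ Icc lo hi, (if FirstExit F lo σ s then (1 : ℝ) else 0)) * (δ * H) := by
      rw [sum_comm]; simp_rw [sum_mul]
    _ ≤ ∑ σ : α ≃ Fin (Fintype.card α), 1 * (δ * H) := by
      refine sum_le_sum fun σ _ => mul_le_mul_of_nonneg_right ?_ (mul_nonneg hδ hH0)
      rw [← sum_filter, sum_const, nsmul_eq_mul, mul_one]
      have : ((Icc lo hi).filter fun s => FirstExit F lo σ s).card ≤ 1 := by
        rw [card_le_one]
        intro s hs t ht
        exact (mem_filter.1 hs).2.unique (mem_filter.1 ht).2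
      exact_mod_cast this
    _ = _ := by rw [sum_const, card_univ, nsmul_eq_mul, one_mul]

/-- Some element of the chain of `σ` added between levels `k` and `k + r` is forced once all
other elements of level `k + r` are present. -/
def Obstructed (F : Finset (Finset α)) (r : ℕ) (σ : α ≃ Fin (Fintype.card α)) (k : ℕ) : Prop :=
  ∃ x ∈ initSeg σ (k + r), x ∉ initSeg σ k ∧ x ∈ forced F ((initSeg σ (k + r)).erase x)

/-- Given the first s entries, the next is uniform among n - s elements, at most hi - s of them
forced. -/
lemma sum_forced_next_le {F : Finset (Finset α)} {lo hi s : ℕ}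
    (hF : ∀ B ∈ F, B.card ≤ hi) (hlo : lo ≤ s) (hs : s ≤ hi) (hn : hi < Fintype.card α)
    (Q : (α ≃ Fin (Fintype.card α)) → Prop) [DecidablePred Q] (hQ : AdaptedTo s Q) :
    ∑ σ : α ≃ Fin (Fintype.card α),
        (if Q σ ∧ σ.symm ⟨s, by omega⟩ ∈ forced F (initSeg σ s) then (1 : ℝ) else 0) ≤
      ((hi : ℝ) - lo) / (Fintype.card α - lo) *
        ∑ σ : α ≃ Fin (Fintype.card α), (if Q σ then (1 : ℝ) else 0) := by
  have hsn : s < Fintype.card α := by omega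
  have hpos : (0 : ℝ) < (Fintype.card α : ℝ) - s := by
    rw [sub_pos]; exact_mod_cast hsn
  have h := sum_next_eq hsn
    (fun σ y => if Q σ ∧ y ∈ forced F (initSeg σ s) then (1 : ℝ) else 0) (by
      intro σ σ' h
      funext y
      simp only [hQ σ σ' h, h s le_rfl])
  have hle : ∑ σ : α ≃ Fin (Fintype.card α), ∑ y ∈ (initSeg σ s)ᶜ,
      (if Q σ ∧ y ∈ forced F (initSeg σ s) then (1 : ℝ) else 0) ≤
      ∑ σ : α ≃ Fin (Fintype.card α), ((hi : ℝ) - s) * (if Q σ then (1 : ℝ) else 0) := by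
    refine sum_le_sum fun σ _ => ?_
    by_cases hq : Q σ
    · simp only [hq, true_and, if_true, mul_one]
      rw [← sum_filter, sum_const, nsmul_eq_mul, mul_one]
      have hc := card_initSeg σ hsn.le
      have h1 := card_forced_le (S := initSeg σ s) hF (by omega)
      rw [hc] at h1
      refine le_trans ?_ h1
      exact_mod_cast card_le_card fun y hy => (mem_filter.1 hy).2
    · simp [hq]
  rw [← mul_sum] at hle
  rw [mul_comm, ← eq_div_iff hpos.ne'] at h
  refine h.trans_le ((div_le_div_of_nonneg_right hle hpos.le).trans ?_)
  rw [mul_div_right_comm]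
  refine mul_le_mul_of_nonneg_right (div_sub_le_div_sub hlo hs le_rfl hn) ?_
  exact sum_nonneg fun σ _ => by split_ifs <;> simp

-- Exchange positions u and k + r - 1. Level k + r is unchanged, level k + r - 1 loses exactly the
-- obstructing element, and that element becomes the next entry and is forced. The new chain is
-- alive at k but not at k + r - 1; keeping this event on the right makes the later sum over k
-- cheap.
open Classical in
lemma sum_alive_forced_le {F : Finset (Finset α)} {lo hi r k : ℕ} (hr : 1 ≤ r)
    (hF : ∀ B ∈ F, B.card ≤ hi) (hlo : lo ≤ k) (hk : k + r ≤ hi) (hn : hi < Fintype.card α)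
    (u : Fin (Fintype.card α)) (hu1 : k ≤ u) (hu2 : u < k + r) :
    ∑ σ : α ≃ Fin (Fintype.card α), (if Alive F lo σ (k + r) ∧
        σ.symm u ∈ forced F ((initSeg σ (k + r)).erase (σ.symm u)) then (1 : ℝ) else 0) ≤
      ((hi : ℝ) - lo) / (Fintype.card α - lo) * ∑ σ : α ≃ Fin (Fintype.card α),
        (if Alive F lo σ k ∧ ¬ Alive F lo σ (k + r - 1) then (1 : ℝ) else 0) := by
  have hv : k + r - 1 < Fintype.card α := by omega
  refine le_trans ?_ (sum_forced_next_le (lo := lo) (s := k + r - 1) hF (by omega) (by omega) hn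
    (fun σ => Alive F lo σ k ∧ ¬ Alive F lo σ (k + r - 1)) ?_)
  · refine le_trans (sum_le_sum fun σ _ => ?_) (Equiv.sum_comp
      ((Equiv.refl α).equivCongr (Equiv.swap u ⟨k + r - 1, hv⟩)) _).le
    have he : (Equiv.refl α).equivCongr (Equiv.swap u ⟨k + r - 1, hv⟩) σ =
        σ.trans (Equiv.swap u ⟨k + r - 1, hv⟩) := by
      ext x; simp [Equiv.equivCongr]
    rw [he]
    by_cases h : Alive F lo σ (k + r) ∧
        σ.symm u ∈ forced F ((initSeg σ (k + r)).erase (σ.symm u))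
    · have hsymm : (σ.trans (Equiv.swap u ⟨k + r - 1, hv⟩)).symm ⟨k + r - 1, hv⟩ = σ.symm u := by
        simp
      have hseg : initSeg (σ.trans (Equiv.swap u ⟨k + r - 1, hv⟩)) (k + r - 1) =
          (initSeg σ (k + r)).erase (σ.symm u) := by
        have h1 := initSeg_succ (σ.trans (Equiv.swap u ⟨k + r - 1, hv⟩)) hv
        rw [hsymm, show k + r - 1 + 1 = k + r by omega, initSeg_swap_of_lt (t := k + r) σ hu2
          (show k + r - 1 < k + r by omega)] at h1
        rw [h1, erase_insert]
        rw [mem_initSeg]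
        simp
      have hf : σ.symm u ∈
          forced F (initSeg (σ.trans (Equiv.swap u ⟨k + r - 1, hv⟩)) (k + r - 1)) := by
        rw [hseg]; exact h.2
      have halive : Alive F lo (σ.trans (Equiv.swap u ⟨k + r - 1, hv⟩)) k := by
        rw [Alive.congr (σ' := σ)]
        · exact h.1.mono (by omega)
        · intro s hs
          exact initSeg_swap σ (by omega) (by simp; omega)
      rw [if_pos h, if_pos]
      refine ⟨⟨halive, fun hcon => ?_⟩, by rw [hsymm]; exact hf⟩
      exact not_upRich_of_mem_forced hf (hcon _ (by omega) le_rfl)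
    · rw [if_neg h]
      split_ifs <;> simp
  · intro σ σ' h
    have h1 := Alive.congr (F := F) (lo := lo) (t := k) (σ := σ) (σ' := σ')
      fun s hs => h s (by omega)
    have h2 := Alive.congr (F := F) (lo := lo) (t := k + r - 1) (σ := σ) (σ' := σ') h
    simp only [h1, h2]

-- One factor r is a union bound over the positions between k and k + r. The other counts levels: a
-- chain dies only once, so the k at which it is alive, but dead by k + r - 1, lie among r
-- consecutive integers.
open Classical in
lemma sum_obstructed_le {F : Finset (Finset α)} {lo hi r : ℕ} (hr : 1 ≤ r)
    (hF : ∀ B ∈ F, B.card ≤ hi) (hlh : lo ≤ hi) (hn : hi < Fintype.card α) :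
    ∑ σ : α ≃ Fin (Fintype.card α),
        ∑ k ∈ (range (hi + 1)).filter (fun k => lo ≤ k ∧ k + r ≤ hi),
          (if Alive F lo σ (k + r) ∧ Obstructed F r σ k then (1 : ℝ) else 0) ≤
      Fintype.card (α ≃ Fin (Fintype.card α)) *
        (((hi : ℝ) - lo) / (Fintype.card α - lo) * (r : ℝ) ^ 2) := by
  set δ : ℝ := ((hi : ℝ) - lo) / (Fintype.card α - lo) with hδdef
  have hδ : 0 ≤ δ := by
    have h1 : (lo : ℝ) ≤ hi := by exact_mod_cast hlh
    have h4 : (hi : ℝ) < Fintype.card α := by exact_mod_cast hn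
    exact div_nonneg (by linarith) (by linarith)
  set K := (range (hi + 1)).filter (fun k => lo ≤ k ∧ k + r ≤ hi) with hK
  let X : ℕ → Finset (Fin (Fintype.card α)) := fun k =>
    univ.filter fun u => k ≤ (u : ℕ) ∧ (u : ℕ) < k + r
  have hX : ∀ k, (X k).card ≤ r := by
    intro k
    have : ((X k).map Fin.valEmbedding) ⊆ Ico k (k + r) := by
      intro i hi
      simp only [X, mem_map, mem_filter, mem_univ, true_and, Fin.valEmbedding_apply] at hi
      obtain ⟨u, hu, rfl⟩ := hi
      exact mem_Ico.2 hu
    simpa using card_le_card this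
  let f : ℕ → (α ≃ Fin (Fintype.card α)) → ℝ := fun k σ =>
    if Alive F lo σ k ∧ ¬ Alive F lo σ (k + r - 1) then (1 : ℝ) else 0
  have hf0 : ∀ k σ, 0 ≤ f k σ := fun k σ => by simp only [f]; split_ifs <;> simp
  have hk : ∀ k ∈ K, ∑ σ : α ≃ Fin (Fintype.card α),
      (if Alive F lo σ (k + r) ∧ Obstructed F r σ k then (1 : ℝ) else 0) ≤
      r * (δ * ∑ σ, f k σ) := by
    intro k hk
    simp only [K, mem_filter, mem_range] at hk
    calc _ ≤ ∑ σ : α ≃ Fin (Fintype.card α), ∑ u ∈ X k, (if Alive F lo σ (k + r) ∧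
          σ.symm u ∈ forced F ((initSeg σ (k + r)).erase (σ.symm u)) then (1 : ℝ) else 0) := by
          refine sum_le_sum fun σ _ => ?_
          have hnn : ∀ u ∈ X k, 0 ≤ (if Alive F lo σ (k + r) ∧
              σ.symm u ∈ forced F ((initSeg σ (k + r)).erase (σ.symm u)) then (1 : ℝ) else 0) :=
            fun u _ => by split_ifs <;> simp
          split_ifs with h
          · obtain ⟨hal, x, hx1, hx2, hx3⟩ := h
            rw [mem_initSeg] at hx1 hx2
            have hmem : σ x ∈ X k := by
              simp only [X, mem_filter, mem_univ, true_and]; omega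
            refine le_trans ?_ (single_le_sum hnn hmem)
            rw [if_pos]
            simpa using ⟨hal, hx3⟩
          · exact sum_nonneg hnn
      _ = _ := sum_comm
      _ ≤ ∑ u ∈ X k, δ * ∑ σ, f k σ := by
          refine sum_le_sum fun u hu => ?_
          simp only [X, mem_filter, mem_univ, true_and] at hu
          exact sum_alive_forced_le hr hF hk.2.1 hk.2.2 hn u hu.1 hu.2
      _ ≤ r * (δ * ∑ σ, f k σ) := by
          rw [sum_const, nsmul_eq_mul]
          refine mul_le_mul_of_nonneg_right (by exact_mod_cast hX k) ?_
          exact mul_nonneg hδ (sum_nonneg fun σ _ => hf0 k σ)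
  have hcount : ∀ σ : α ≃ Fin (Fintype.card α), ∑ k ∈ K, f k σ ≤ r := by
    intro σ
    simp only [f]
    rw [← sum_filter, sum_const, nsmul_eq_mul, mul_one]
    set L := K.filter fun k => Alive F lo σ k ∧ ¬ Alive F lo σ (k + r - 1)
    rcases L.eq_empty_or_nonempty with h | h
    · rw [h]; simp
    · have hsub : L ⊆ Ico (L.min' h) (L.min' h + r) := by
        intro k hkL
        have h1 := (mem_filter.1 hkL).2.1
        have h2 := (mem_filter.1 (L.min'_mem h)).2.2
        refine mem_Ico.2 ⟨L.min'_le k hkL, ?_⟩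
        by_contra hcon
        exact h2 (h1.mono (by omega))
      have := card_le_card hsub
      rw [Nat.card_Ico] at this
      exact_mod_cast this.trans (by omega)
  calc _ = _ := sum_comm
    _ ≤ ∑ k ∈ K, r * (δ * ∑ σ, f k σ) := sum_le_sum hk
    _ = r * (δ * ∑ σ, ∑ k ∈ K, f k σ) := by
      rw [← mul_sum, ← mul_sum, sum_comm]
    _ ≤ r * (δ * ∑ σ : α ≃ Fin (Fintype.card α), (r : ℝ)) := by
      gcongr with σ _
      exact hcount σ
    _ = _ := by
      rw [sum_const, card_univ, nsmul_eq_mul]; ring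

end Crowns

/-! ### The Lubell mass of a crown-free family -/

section Core

open Finset

variable {α : Type*} [Fintype α] [DecidableEq α]

/-- If the chain of `σ` is rich from below up to level `k + r` and from above down to level `k`,
then, unless it is obstructed, a crown can be read off. -/
lemma hasCrown_of_not_obstructed {F : Finset (Finset α)} {lo lo' r k : ℕ}
    (hkr : k + r ≤ Fintype.card α) (σ : α ≃ Fin (Fintype.card α))
    (hlo : lo ≤ k) (hlo' : lo' ≤ Fintype.card α - (k + r))
    (h1 : Alive F lo σ (k + r))
    (h2 : Alive (complFamily F) lo' (σ.trans Fin.revPerm) (Fintype.card α - k))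
    (h3 : ¬ Obstructed F r σ k)
    (h4 : ¬ Obstructed (complFamily F) r (σ.trans Fin.revPerm) (Fintype.card α - (k + r))) :
    HasCrown r F := by
  set T := initSeg σ (k + r) with hT
  set D := initSeg σ k with hD
  have hDT : D ⊆ T := initSeg_mono σ (by omega)
  have hDc : initSeg (σ.trans Fin.revPerm) (Fintype.card α - k) = Dᶜ := initSeg_rev σ (by omega)
  have hTc : initSeg (σ.trans Fin.revPerm) (Fintype.card α - (k + r)) = Tᶜ := initSeg_rev σ hkr
  -- Richness of T gives some member above T \ {x}; if all of them contained x, then x would be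
  -- forced. The next claim is the dual, for complements along the reversed chain.
  have ha : ∀ x ∈ T, x ∉ D → ∃ a ∈ F, T.erase x ⊆ a ∧ x ∉ a := by
    intro x hxT hxD
    by_contra! hcon
    refine h3 ⟨x, hxT, hxD, ?_⟩
    simp only [forced, mem_filter, mem_univ, true_and]
    refine ⟨by simp, ?_, hcon⟩
    obtain ⟨a, haF, hTa⟩ := (h1 (k + r) (by omega) le_rfl).1
    exact ⟨a, haF, (erase_subset x _).trans hTa⟩
  have hb : ∀ x ∈ T, x ∉ D → ∃ b ∈ F, b ⊆ insert x D ∧ x ∈ b := by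
    intro x hxT hxD
    by_contra! hcon
    have he : Fintype.card α - (k + r) + r = Fintype.card α - k := by omega
    refine h4 ⟨x, ?_, ?_, ?_⟩
    · rw [he, hDc]; simpa using hxD
    · rw [hTc]; simpa using hxT
    · rw [he, hDc]
      simp only [forced, mem_filter, mem_univ, true_and]
      refine ⟨by simp, ?_, ?_⟩
      · obtain ⟨a, haF, hTa⟩ := (h2 (Fintype.card α - k) (by omega) le_rfl).1
        rw [hDc] at hTa
        exact ⟨a, haF, (erase_subset x _).trans hTa⟩
      · intro a haF hsub
        by_contra hxa
        refine hcon aᶜ (mem_complFamily.1 haF) ?_ (mem_compl.2 hxa)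
        intro y hy
        by_contra hy'
        rw [mem_insert, not_or] at hy'
        exact (mem_compl.1 hy) (hsub (mem_erase.2 ⟨hy'.1, mem_compl.2 hy'.2⟩))
  let x : Fin r → α := fun i => σ.symm ⟨k + i, by omega⟩
  have hx : ∀ i, x i ∈ T ∧ x i ∉ D := by
    intro i
    simp [x, hT, hD]
  have hinj : ∀ i j, x i = x j → i = j := by
    intro i j hij
    have := σ.symm.injective hij
    simp only [Fin.mk.injEq] at this
    ext; omega
  choose a haF hTa hxa using fun i => ha (x i) (hx i).1 (hx i).2
  choose b hbF hbD hxb using fun i => hb (x i) (hx i).1 (hx i).2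
  refine ⟨a, b, haF, hbF, fun i j => ⟨?_, ?_⟩⟩
  · rintro h rfl
    exact hxa i (h (hxb i))
  · intro hij y hy
    refine hTa i (mem_erase.2 ?_)
    rcases mem_insert.1 (hbD j hy) with rfl | hyD
    · exact ⟨fun h => hij (hinj _ _ h).symm, (hx j).1⟩
    · exact ⟨fun h => (hx i).2 (h ▸ hyD), hDT hyD⟩

lemma card_mul_lubell_eq {F : Finset (Finset α)} {lo hi : ℕ}
    (hF : ∀ B ∈ F, lo ≤ B.card ∧ B.card ≤ hi) (hn : hi ≤ Fintype.card α) :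
    (Fintype.card (α ≃ Fin (Fintype.card α)) : ℝ) * lubell F =
      ∑ σ : α ≃ Fin (Fintype.card α), ∑ k ∈ Icc lo hi,
        (if initSeg σ k ∈ F then (1 : ℝ) else 0) := by
  have h := sum_hits_eq F (s := 0) (by omega) (fun _ => 1) (fun _ _ _ => rfl)
  have h0 : ∀ σ : α ≃ Fin (Fintype.card α), initSeg σ 0 = ∅ := by
    intro σ; ext x; simp
  simp only [one_mul, h0, upLubell_empty, sum_const, card_univ, nsmul_eq_mul] at h
  rw [← h]
  refine sum_congr rfl fun σ _ => (sum_subset ?_ ?_).symm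
  · intro k hk
    rw [mem_Icc] at *
    omega
  · intro k hk hk'
    rw [if_neg]
    intro hmem
    have := hF _ hmem
    rw [card_initSeg σ (mem_Icc.1 hk).2] at this
    exact hk' (mem_Icc.2 this)

open Classical in
/-- A crown-free chain meets `F` in at most `r` levels, up to levels at which it is not rich and
up to obstructions. -/
lemma hits_le {F : Finset (Finset α)} {lo hi r : ℕ} (hlo : 0 < lo) (hn : hi < Fintype.card α)
    (hcr : ¬ HasCrown r F) (σ : α ≃ Fin (Fintype.card α)) :
    ∑ k ∈ Icc lo hi, (if initSeg σ k ∈ F then (1 : ℝ) else 0) ≤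
      r + ∑ k ∈ Icc lo hi, (if initSeg σ k ∈ F ∧ ¬ Alive F lo σ k then (1 : ℝ) else 0) +
      ∑ k ∈ Icc (Fintype.card α - hi) (Fintype.card α - lo),
        (if initSeg (σ.trans Fin.revPerm) k ∈ complFamily F ∧
          ¬ Alive (complFamily F) (Fintype.card α - hi) (σ.trans Fin.revPerm) k
          then (1 : ℝ) else 0) +
      ∑ k ∈ (range (hi + 1)).filter (fun k => lo ≤ k ∧ k + r ≤ hi),
          (if Alive F lo σ (k + r) ∧ Obstructed F r σ k then (1 : ℝ) else 0) +
      ∑ k ∈ (range (Fintype.card α - lo + 1)).filter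
          (fun k => Fintype.card α - hi ≤ k ∧ k + r ≤ Fintype.card α - lo),
          (if Alive (complFamily F) (Fintype.card α - hi) (σ.trans Fin.revPerm) (k + r) ∧
            Obstructed (complFamily F) r (σ.trans Fin.revPerm) k then (1 : ℝ) else 0) := by
  set F' := complFamily F
  set σ' := σ.trans Fin.revPerm with hσ'
  simp only [← sum_filter, sum_const, nsmul_eq_mul, mul_one]
  set A := (Icc lo hi).filter fun k => initSeg σ k ∈ F
  set B := (Icc lo hi).filter fun k => initSeg σ k ∈ F ∧ ¬ Alive F lo σ k
  set B' := (Icc (Fintype.card α - hi) (Fintype.card α - lo)).filter fun k =>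
    initSeg σ' k ∈ F' ∧ ¬ Alive F' (Fintype.card α - hi) σ' k
  set E := ((range (hi + 1)).filter fun k => lo ≤ k ∧ k + r ≤ hi).filter fun k =>
    Alive F lo σ (k + r) ∧ Obstructed F r σ k
  set E' := ((range (Fintype.card α - lo + 1)).filter fun k =>
      Fintype.card α - hi ≤ k ∧ k + r ≤ Fintype.card α - lo).filter fun k =>
    Alive F' (Fintype.card α - hi) σ' (k + r) ∧ Obstructed F' r σ' k
  set A₁ := A.filter fun k => Alive F lo σ k ∧ Alive F' (Fintype.card α - hi) σ' (Fintype.card α - k)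
  have hA : A ⊆ A₁ ∪ B ∪ B'.image (Fintype.card α - ·) := by
    intro k hk
    have hk' := mem_filter.1 hk
    rw [mem_Icc] at hk'
    by_cases h1 : Alive F lo σ k
    · by_cases h2 : Alive F' (Fintype.card α - hi) σ' (Fintype.card α - k)
      · exact mem_union_left _ (mem_union_left _ (mem_filter.2 ⟨hk, h1, h2⟩))
      · refine mem_union_right _ (mem_image.2 ⟨Fintype.card α - k,
          mem_filter.2 ⟨?_, ?_, h2⟩, by omega⟩)
        · rw [mem_Icc]; omega
        · rw [mem_complFamily, hσ', initSeg_rev σ (by omega), compl_compl]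
          exact hk'.2
    · exact mem_union_left _ (mem_union_right _ (mem_filter.2 ⟨mem_Icc.2 hk'.1, hk'.2, h1⟩))
  -- Let m be the top level in `A₁`. At most r levels exceed m - r. For the others k + r ≤ m, so the
  -- chain is rich from below up to k + r and from above down to k, and the absence of a crown
  -- forces an obstruction. Since `lo` is positive, the truncation in m - r does no harm.
  have hA₁ : A₁ ⊆ Ioc (A₁.sup id - r) (A₁.sup id) ∪
      (E ∪ E'.image (fun k => Fintype.card α - (k + r))) := by
    intro k hk
    have hksup : k ≤ A₁.sup id := le_sup (f := id) hk
    by_cases hkr : A₁.sup id - r < k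
    · exact mem_union_left _ (mem_Ioc.2 ⟨hkr, hksup⟩)
    refine mem_union_right _ ?_
    obtain ⟨m, hm, hmeq⟩ := exists_mem_eq_sup A₁ ⟨k, hk⟩ id
    simp only [id] at hmeq
    have hmem : ∀ j ∈ A₁, lo ≤ j ∧ j ≤ hi ∧ Alive F lo σ j ∧
        Alive F' (Fintype.card α - hi) σ' (Fintype.card α - j) := by
      intro j hj
      have h1 := mem_filter.1 hj
      have h2 := (mem_filter.1 h1.1).1
      rw [mem_Icc] at h2
      exact ⟨h2.1, h2.2, h1.2⟩
    obtain ⟨hk1, hk2, -, hk4⟩ := hmem k hk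
    obtain ⟨hm1, hm2, hm3, -⟩ := hmem m hm
    have hal : Alive F lo σ (k + r) := hm3.mono (by omega)
    by_contra hcon
    rw [mem_union, not_or] at hcon
    refine hcr (hasCrown_of_not_obstructed (k := k) (lo' := Fintype.card α - hi) (by omega) σ hk1 (by omega)
      hal hk4 ?_ ?_)
    · intro hob
      refine hcon.1 (mem_filter.2 ⟨mem_filter.2 ⟨?_, ?_⟩, hal, hob⟩)
      · rw [mem_range]; omega
      · omega
    · intro hob
      refine hcon.2 (mem_image.2 ⟨Fintype.card α - (k + r),
        mem_filter.2 ⟨mem_filter.2 ⟨?_, ?_⟩, ?_, hob⟩, ?_⟩)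
      · rw [mem_range]; omega
      · omega
      · rwa [show Fintype.card α - (k + r) + r = Fintype.card α - k by omega]
      · omega
  have c1 : A.card ≤ A₁.card + B.card + B'.card := by
    refine (card_le_card hA).trans ((card_union_le _ _).trans ?_)
    exact add_le_add (card_union_le _ _) card_image_le
  have c2 : A₁.card ≤ r + (E.card + E'.card) := by
    refine (card_le_card hA₁).trans ((card_union_le _ _).trans (add_le_add ?_ ?_))
    · rw [Nat.card_Ioc]; omega
    · exact (card_union_le _ _).trans (add_le_add le_rfl card_image_le)
  have : A.card ≤ r + B.card + B'.card + E.card + E'.card := by omega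
  exact_mod_cast this

/-- The main estimate: a crown-free family on the levels from `lo` to `hi` has Lubell mass at most
`r`, up to errors that are controlled by the Lubell masses of its links. -/
theorem lubell_le_of_not_hasCrown {F : Finset (Finset α)} {lo hi r : ℕ} {H H' : ℝ}
    (hr : 1 ≤ r) (hF : ∀ B ∈ F, lo ≤ B.card ∧ B.card ≤ hi) (hlo : 0 < lo) (hlh : lo ≤ hi)
    (hn : hi < Fintype.card α) (hcr : ¬ HasCrown r F) (hH0 : 0 ≤ H) (hH0' : 0 ≤ H')
    (hH : ∀ A : Finset α, lo ≤ A.card → A.card ≤ hi → upLubell F A ≤ H)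
    (hH' : ∀ A : Finset α, Fintype.card α - hi ≤ A.card → A.card ≤ Fintype.card α - lo →
      upLubell (complFamily F) A ≤ H') :
    lubell F ≤ r + ((hi : ℝ) - lo) / (Fintype.card α - lo) * (H + r ^ 2) +
      ((hi : ℝ) - lo) / hi * (H' + r ^ 2) := by
  classical
  have hF' : ∀ B ∈ complFamily F, B.card ≤ Fintype.card α - lo := by
    intro B hB
    have h1 := (hF _ (mem_complFamily.1 hB)).1
    rw [card_compl] at h1
    omega
  set M : ℝ := (Fintype.card (α ≃ Fin (Fintype.card α)) : ℝ) with hM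
  have hMpos : 0 < M := by
    have : Nonempty (α ≃ Fin (Fintype.card α)) := ⟨Fintype.equivFin α⟩
    rw [hM]; exact_mod_cast Fintype.card_pos
  have hδ' : (((Fintype.card α - lo : ℕ) : ℝ) - ((Fintype.card α - hi : ℕ) : ℝ)) /
      ((Fintype.card α : ℝ) - ((Fintype.card α - hi : ℕ) : ℝ)) =
      ((hi : ℝ) - lo) / hi := by
    rw [Nat.cast_sub (by omega), Nat.cast_sub (by omega)]
    congr 1 <;> ring
  have e1 := sum_hits_not_alive_le (fun B hB => (hF B hB).2) hlh hn hH0 hH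
  have e2 := sum_hits_not_alive_le hF' (lo := Fintype.card α - hi) (by omega) (by omega) hH0' hH'
  have e3 := sum_obstructed_le hr (fun B hB => (hF B hB).2) hlh hn
  have e4 := sum_obstructed_le hr hF' (lo := Fintype.card α - hi) (by omega) (by omega)
  rw [hδ'] at e2 e4
  -- Reversal permutes the chains, so the bounds for the complements may be summed over reversed
  -- chains.
  rw [← Equiv.sum_comp ((Equiv.refl α).equivCongr Fin.revPerm)] at e2 e4
  have htot := sum_le_sum fun σ (_ : σ ∈ univ) => hits_le hlo hn hcr σ
  rw [← card_mul_lubell_eq hF hn.le] at htot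
  simp only [sum_add_distrib, sum_const, card_univ, nsmul_eq_mul] at htot
  have hkey : M * lubell F ≤ M * (r + ((hi : ℝ) - lo) / (Fintype.card α - lo) * (H + r ^ 2) +
      ((hi : ℝ) - lo) / hi * (H' + r ^ 2)) := by
    refine htot.trans ((add_le_add (add_le_add (add_le_add (add_le_add le_rfl e1) e2) e3) e4).trans
      (le_of_eq ?_))
    ring
  exact le_of_mul_le_mul_left hkey hMpos

end Core

/-! ### Links and an a priori bound -/

section Links

open Finset

variable {α : Type*} [Fintype α] [DecidableEq α]

lemma lubell_le_card_levels {F : Finset (Finset α)} {lo hi : ℕ}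
    (hF : ∀ B ∈ F, lo ≤ B.card ∧ B.card ≤ hi) (hn : hi ≤ Fintype.card α) :
    lubell F ≤ ((hi + 1 - lo : ℕ) : ℝ) := by
  have hMpos : (0 : ℝ) < (Fintype.card (α ≃ Fin (Fintype.card α)) : ℝ) := by
    have : Nonempty (α ≃ Fin (Fintype.card α)) := ⟨Fintype.equivFin α⟩
    exact_mod_cast Fintype.card_pos
  refine le_of_mul_le_mul_left ?_ hMpos
  rw [card_mul_lubell_eq hF hn]
  refine (sum_le_card_nsmul univ _ ((hi + 1 - lo : ℕ) : ℝ) fun σ _ => ?_).trans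
    (by rw [nsmul_eq_mul, card_univ])
  rw [← sum_filter, sum_const, nsmul_eq_mul, mul_one, ← Nat.card_Icc]
  exact_mod_cast card_filter_le _ _

/-- The link of `A` in `F`: the sets `B \ A` for the members `B` of `F` above `A`. -/
def link (F : Finset (Finset α)) (A : Finset α) : Finset (Finset {x // x ∉ A}) :=
  univ.filter fun C => A ∪ C.map (Function.Embedding.subtype _) ∈ F

lemma mem_link {F : Finset (Finset α)} {A : Finset α} {C : Finset {x // x ∉ A}} :
    C ∈ link F A ↔ A ∪ C.map (Function.Embedding.subtype _) ∈ F := by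
  simp [link]

lemma disjoint_map_subtype (A : Finset α) (C : Finset {x // x ∉ A}) :
    Disjoint A (C.map (Function.Embedding.subtype _)) := by
  rw [disjoint_left]
  intro x hx hxC
  simp only [mem_map, Function.Embedding.subtype_apply] at hxC
  obtain ⟨y, -, rfl⟩ := hxC
  exact y.2 hx

lemma card_union_map_subtype (A : Finset α) (C : Finset {x // x ∉ A}) :
    (A ∪ C.map (Function.Embedding.subtype _)).card = A.card + C.card := by
  rw [card_union_of_disjoint (disjoint_map_subtype A C), card_map]

lemma union_map_subtype_subset_iff (A : Finset α) (C D : Finset {x // x ∉ A}) :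
    A ∪ C.map (Function.Embedding.subtype _) ⊆ A ∪ D.map (Function.Embedding.subtype _) ↔
      C ⊆ D := by
  constructor
  · intro h x hx
    have h1 : (x : α) ∈ A ∪ C.map (Function.Embedding.subtype _) :=
      mem_union_right _ (mem_map_of_mem _ hx)
    rcases mem_union.1 (h h1) with h2 | h2
    · exact absurd h2 x.2
    · simpa [x.2] using h2
  · intro h
    exact union_subset_union_right (map_subset_map.2 h)

lemma HasCrown.of_link {r : ℕ} {F : Finset (Finset α)} {A : Finset α}
    (h : HasCrown r (link F A)) : HasCrown r F := by
  obtain ⟨a, b, ha, hb, hab⟩ := h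
  refine ⟨fun i => A ∪ (a i).map (Function.Embedding.subtype _),
    fun i => A ∪ (b i).map (Function.Embedding.subtype _), fun i => mem_link.1 (ha i),
    fun i => mem_link.1 (hb i), fun i j => ?_⟩
  rw [union_map_subtype_subset_iff, hab]

lemma card_notMem (A : Finset α) :
    Fintype.card {x // x ∉ A} = Fintype.card α - A.card := by
  rw [Fintype.card_subtype_compl, Fintype.card_coe]

lemma lubell_link (F : Finset (Finset α)) (A : Finset α) : lubell (link F A) = upLubell F A := by
  refine sum_bij' (fun C _ => A ∪ C.map (Function.Embedding.subtype _))
    (fun B _ => B.subtype (· ∉ A)) ?_ ?_ ?_ ?_ ?_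
  · intro C hC
    exact mem_filter.2 ⟨mem_link.1 hC, subset_union_left⟩
  · intro B hB
    obtain ⟨hBF, hAB⟩ := mem_filter.1 hB
    rw [mem_link, subtype_map]
    convert hBF
    ext x
    simp only [mem_union, mem_filter]
    exact ⟨fun h => h.elim (fun h => hAB h) And.left, fun h => by tauto⟩
  · intro C _
    ext x
    simp [x.2]
  · intro B hB
    obtain ⟨hBF, hAB⟩ := mem_filter.1 hB
    rw [subtype_map]
    ext x
    simp only [mem_union, mem_filter]
    exact ⟨fun h => h.elim (fun h => hAB h) And.left, fun h => by tauto⟩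
  · intro C _
    rw [card_notMem, card_union_map_subtype, Nat.add_sub_cancel_left]

lemma upLubell_le_card_levels {F : Finset (Finset α)} {lo hi : ℕ}
    (hF : ∀ B ∈ F, lo ≤ B.card ∧ B.card ≤ hi) (hn : hi ≤ Fintype.card α) {A : Finset α}
    (hlo : lo ≤ A.card) (hhi : A.card ≤ hi) : upLubell F A ≤ (hi : ℝ) - lo + 1 := by
  rw [← lubell_link]
  refine (lubell_le_card_levels (lo := 0) (hi := hi - A.card) ?_ ?_).trans ?_
  · intro C hC
    have := hF _ (mem_link.1 hC)
    rw [card_union_map_subtype] at this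
    omega
  · rw [card_notMem]; omega
  · have h1 : (lo : ℝ) ≤ A.card := by exact_mod_cast hlo
    have h2 : ((hi - A.card + 1 - 0 : ℕ) : ℝ) = hi - A.card + 1 := by
      rw [Nat.sub_zero, Nat.cast_add, Nat.cast_sub hhi, Nat.cast_one]
    rw [h2]; linarith

lemma card_mem_complFamily {F : Finset (Finset α)} {lo hi : ℕ}
    (hF : ∀ B ∈ F, lo ≤ B.card ∧ B.card ≤ hi) (hn : hi ≤ Fintype.card α) :
    ∀ B ∈ complFamily F, Fintype.card α - hi ≤ B.card ∧ B.card ≤ Fintype.card α - lo := by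
  intro B hB
  have h1 := hF _ (mem_complFamily.1 hB)
  rw [card_compl] at h1
  have := card_le_univ B
  omega

/-- The bound for a crown-free family on `w` consecutive levels. -/
lemma lubell_window_le {F : Finset (Finset α)} {lo hi r w : ℕ} (hr : 1 ≤ r)
    (hF : ∀ B ∈ F, lo ≤ B.card ∧ B.card ≤ hi) (hlo : 0 < lo) (hw : hi + 1 = lo + w) (hw0 : 1 ≤ w)
    (hn : hi < Fintype.card α) (hcr : ¬ HasCrown r F) :
    lubell F ≤ r + ((w : ℝ) / (Fintype.card α - lo) + (w : ℝ) / hi) * (w + r ^ 2) := by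
  have hwr : (hi : ℝ) - lo + 1 = w := by
    have : (hi : ℝ) + 1 = lo + w := by exact_mod_cast hw
    linarith
  have hlh : lo ≤ hi := by omega
  -- In a narrow window the trivial bound for links, the number w of levels, is good enough.
  have h := lubell_le_of_not_hasCrown (H := w) (H' := w) hr hF hlo hlh hn hcr (by positivity)
    (by positivity) (fun A h1 h2 => hwr ▸ upLubell_le_card_levels hF hn.le h1 h2) (by
      intro A h1 h2
      have := upLubell_le_card_levels (card_mem_complFamily hF hn.le) (by omega) h1 h2
      rw [Nat.cast_sub (by omega), Nat.cast_sub (by omega)] at this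
      linarith)
  have hlo' : (lo : ℝ) ≤ hi := by exact_mod_cast hlh
  have h0 : (0 : ℝ) < lo := by exact_mod_cast hlo
  have hn' : (hi : ℝ) < Fintype.card α := by exact_mod_cast hn
  have e1 : ((hi : ℝ) - lo) / (Fintype.card α - lo) ≤ (w : ℝ) / (Fintype.card α - lo) :=
    div_le_div_of_nonneg_right (by linarith) (by linarith)
  have e2 : ((hi : ℝ) - lo) / hi ≤ (w : ℝ) / hi :=
    div_le_div_of_nonneg_right (by linarith) (by linarith)
  have hp : (0 : ℝ) ≤ (w : ℝ) + r ^ 2 := by positivity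
  have f1 := mul_le_mul_of_nonneg_right e1 hp
  have f2 := mul_le_mul_of_nonneg_right e2 hp
  rw [add_mul]
  linarith

/-- A weak bound for crown-free families on the levels up to `M`, obtained by cutting them into
windows of `w` levels. -/
lemma lubell_le_of_card_le {F : Finset (Finset α)} {r w l M N : ℕ} (hr : 1 ≤ r)
    (hF : ∀ B ∈ F, B.card ≤ M) (hw : 1 ≤ w) (hl : 1 ≤ l) (hN : 2 * (l + M + w) ≤ N)
    (hn : N ≤ Fintype.card α) (hcr : ¬ HasCrown r F) :
    lubell F ≤ l + ((M / w : ℕ) + 1) * (r + (2 * (w : ℝ) / N + (w : ℝ) / l) * (w + r ^ 2)) := by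
  -- Levels below l are split off because the error w / `hi` of a window is large near the empty
  -- set; they contribute at most l.
  have hsplit : lubell F = lubell (F.filter fun B => B.card < l) +
      lubell (F.filter fun B => ¬ B.card < l) :=
    (sum_filter_add_sum_filter_not F (fun B => B.card < l) _).symm
  have hsmall : lubell (F.filter fun B => B.card < l) ≤ l := by
    refine (lubell_le_card_levels (lo := 0) (hi := l - 1) ?_ (by omega)).trans ?_
    · intro B hB
      have := (mem_filter.1 hB).2
      omega
    · exact_mod_cast (by omega : l - 1 + 1 - 0 ≤ l)
  have hlarge : lubell (F.filter fun B => ¬ B.card < l) = ∑ j ∈ range (M / w + 1),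
      lubell ((F.filter fun B => ¬ B.card < l).filter fun B => (B.card - l) / w = j) := by
    refine (sum_fiberwise_of_maps_to ?_ _).symm
    intro B hB
    have := hF B (mem_filter.1 hB).1
    rw [mem_range, Nat.lt_succ_iff]
    exact Nat.div_le_div_right (by omega)
  have hwin : ∀ j ∈ range (M / w + 1),
      lubell ((F.filter fun B => ¬ B.card < l).filter fun B => (B.card - l) / w = j) ≤
        r + (2 * (w : ℝ) / N + (w : ℝ) / l) * (w + r ^ 2) := by
    intro j hj
    rw [mem_range, Nat.lt_succ_iff] at hj
    have hjM : j * w ≤ M := (Nat.mul_le_mul_right w hj).trans (Nat.div_mul_le_self M w)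
    have hb := lubell_window_le (F := (F.filter fun B => ¬ B.card < l).filter
      fun B => (B.card - l) / w = j) (lo := l + j * w) (hi := l + j * w + w - 1) (r := r) (w := w)
      hr ?_ (by omega) (by omega) hw (by omega) ?_
    · refine hb.trans ?_
      have hNpos : (0 : ℝ) < N := by exact_mod_cast (by omega : 0 < N)
      have hlpos : (0 : ℝ) < l := by exact_mod_cast hl
      have h1 : (w : ℝ) / ((Fintype.card α : ℝ) - (l + j * w : ℕ)) ≤ 2 * (w : ℝ) / N := by
        have : (N : ℝ) / 2 ≤ (Fintype.card α : ℝ) - (l + j * w : ℕ) := by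
          have : N + 2 * (l + j * w) ≤ 2 * Fintype.card α := by omega
          have : (N : ℝ) + 2 * (l + j * w : ℕ) ≤ 2 * Fintype.card α := by exact_mod_cast this
          linarith
        calc (w : ℝ) / ((Fintype.card α : ℝ) - (l + j * w : ℕ)) ≤ (w : ℝ) / (N / 2) :=
              div_le_div_of_nonneg_left (by positivity) (by positivity) this
          _ = _ := by field_simp
      have h2 : (w : ℝ) / (l + j * w + w - 1 : ℕ) ≤ (w : ℝ) / l := by
        refine div_le_div_of_nonneg_left (by positivity) hlpos ?_
        exact_mod_cast (by omega : l ≤ l + j * w + w - 1)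
      gcongr
    · intro B hB
      simp only [mem_filter] at hB
      obtain ⟨⟨-, hBl⟩, hBj⟩ := hB
      rw [Nat.div_eq_iff (by omega)] at hBj
      omega
    · intro h
      exact hcr (h.mono ((filter_subset _ _).trans (filter_subset _ _)))
  rw [hsplit, hlarge]
  refine add_le_add hsmall ((sum_le_sum hwin).trans ?_)
  rw [sum_const, card_range, nsmul_eq_mul]
  push_cast
  exact le_rfl

/-- The bound for crown-free families on levels `lo` to `hi` that are far from both ends. -/
theorem lubell_middle_le {F : Finset (Finset α)} {lo hi r w l N : ℕ} (hr : 1 ≤ r)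
    (hF : ∀ B ∈ F, lo ≤ B.card ∧ B.card ≤ hi) (hlh : lo ≤ hi) (hw : 1 ≤ w) (hl : 1 ≤ l)
    (hN : 2 * (l + (hi - lo) + w) ≤ N) (hNlo : N ≤ lo) (hNhi : N + hi ≤ Fintype.card α)
    (hcr : ¬ HasCrown r F) :
    lubell F ≤ r + 2 * (((hi - lo : ℕ) : ℝ) / N) *
      (l + (((hi - lo) / w : ℕ) + 1) * (r + (2 * (w : ℝ) / N + (w : ℝ) / l) * (w + r ^ 2)) +
        r ^ 2) := by
  -- This is the bound of `lubell_le_of_card_le` for a link, which lives on levels up to `hi - lo`.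
  set H : ℝ := l + (((hi - lo) / w : ℕ) + 1) *
    (r + (2 * (w : ℝ) / N + (w : ℝ) / l) * (w + r ^ 2)) with hHdef
  have hlink : ∀ G : Finset (Finset α), ¬ HasCrown r G →
      ∀ A : Finset α, (∀ B ∈ G, B.card ≤ A.card + (hi - lo)) →
        N + A.card ≤ Fintype.card α → upLubell G A ≤ H := by
    intro G hG A hA hNA
    rw [← lubell_link]
    refine lubell_le_of_card_le hr ?_ hw hl hN ?_ fun h => hG h.of_link
    · intro C hC
      have := hA _ (mem_link.1 hC)
      rw [card_union_map_subtype] at this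
      omega
    · rw [card_notMem]; omega
  have hH0 : 0 ≤ H := by rw [hHdef]; positivity
  have h := lubell_le_of_not_hasCrown (H := H) (H' := H) hr hF (by omega) hlh (by omega) hcr hH0
    hH0 (fun A h1 h2 => hlink F hcr A (fun B hB => by have := (hF B hB).2; omega) (by omega))
    (fun A h1 h2 => hlink _ (fun h => hcr h.complFamily) A (fun B hB => by
      have := (card_mem_complFamily hF (by omega) B hB).2
      omega) (by omega))
  have hNpos : (0 : ℝ) < N := by exact_mod_cast (by omega : 0 < N)
  rw [← Nat.cast_sub hlh] at h
  have e1 : ((hi - lo : ℕ) : ℝ) / (Fintype.card α - lo) ≤ ((hi - lo : ℕ) : ℝ) / N := by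
    refine div_le_div_of_nonneg_left (by positivity) hNpos ?_
    have : (N : ℝ) + lo ≤ Fintype.card α := by exact_mod_cast (by omega)
    linarith
  have e2 : ((hi - lo : ℕ) : ℝ) / hi ≤ ((hi - lo : ℕ) : ℝ) / N := by
    refine div_le_div_of_nonneg_left (by positivity) hNpos ?_
    exact_mod_cast (by omega : N ≤ hi)
  have hp : 0 ≤ H + (r : ℝ) ^ 2 := by positivity
  have f1 := mul_le_mul_of_nonneg_right e1 hp
  have f2 := mul_le_mul_of_nonneg_right e2 hp
  linarith

end Links

/-! ### The asymptotic upper bound -/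

section Asymptotics

open Finset Filter

lemma two_pow_le_mul_choose_half (n : ℕ) : 2 ^ n ≤ (n + 1) * n.choose (n / 2) := by
  rw [← Nat.sum_range_choose]
  refine (sum_le_card_nsmul _ _ (n.choose (n / 2)) fun k _ => Nat.choose_le_middle k n).trans ?_
  simp

lemma choose_half_pos (n : ℕ) : (0 : ℝ) < n.choose (n / 2) := by
  exact_mod_cast Nat.choose_pos (Nat.div_le_self n 2)

/-- The sum factors as (exp t + exp(-t))^n, and cosh t ≤ exp(t²/2). -/
lemma sum_exp_card {n : ℕ} (t : ℝ) :
    ∑ B : Finset (Fin n), Real.exp (t * (2 * B.card - n)) ≤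
      2 ^ n * Real.exp (n * (t ^ 2 / 2)) := by
  have h := Fintype.sum_pow_mul_eq_add_pow (Fin n) (Real.exp t) (Real.exp (-t))
  have h1 : ∀ B : Finset (Fin n), Real.exp (t * (2 * B.card - n)) =
      Real.exp t ^ B.card * Real.exp (-t) ^ (Fintype.card (Fin n) - B.card) := by
    intro B
    have hB : B.card ≤ Fintype.card (Fin n) := card_le_univ B
    rw [← Real.exp_nat_mul, ← Real.exp_nat_mul, ← Real.exp_add, Nat.cast_sub hB, Fintype.card_fin]
    congr 1
    ring
  simp_rw [h1]
  rw [h, Fintype.card_fin, Real.exp_nat_mul, ← mul_pow]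
  refine pow_le_pow_left₀ (by positivity) ?_ n
  have := Real.cosh_le_exp_half_sq t
  rw [Real.cosh_eq] at this
  linarith

/-- A Chernoff bound for the number of sets whose size is far from `n / 2`. -/
lemma card_far_le {n m : ℕ} (hn : 0 < n) (G : Finset (Finset (Fin n)))
    (hG : ∀ B ∈ G, B.card + m < n / 2 ∨ n / 2 + m < B.card) :
    (G.card : ℝ) ≤ 2 * (n + 1) * Real.exp (-(2 * (m : ℝ) ^ 2 / n)) * n.choose (n / 2) := by
  have hn' : (0 : ℝ) < n := by exact_mod_cast hn
  -- This t minimises the exponent -2mt + nt²/2.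
  set t : ℝ := 2 * m / n with ht
  have ht0 : 0 ≤ t := by positivity
  have hpt : ∀ B ∈ G, (1 : ℝ) ≤ Real.exp (-(2 * m * t)) *
      (Real.exp (t * (2 * B.card - n)) + Real.exp (-t * (2 * B.card - n))) := by
    intro B hB
    rw [mul_add, ← Real.exp_add, ← Real.exp_add]
    rcases hG B hB with h | h
    · have h' : 2 * B.card + 2 * m ≤ n := by omega
      have h' : 2 * (B.card : ℝ) + 2 * m ≤ n := by exact_mod_cast h'
      have : 0 ≤ -(2 * m * t) + -t * (2 * B.card - n) := by nlinarith
      linarith [Real.one_le_exp this, Real.exp_pos (-(2 * m * t) + t * (2 * B.card - n))]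
    · have h' : n + 2 * m ≤ 2 * B.card := by omega
      have h' : (n : ℝ) + 2 * m ≤ 2 * B.card := by exact_mod_cast h'
      have : 0 ≤ -(2 * m * t) + t * (2 * B.card - n) := by nlinarith
      linarith [Real.one_le_exp this, Real.exp_pos (-(2 * m * t) + -t * (2 * B.card - n))]
  have h2n : (2 : ℝ) ^ n ≤ (n + 1) * n.choose (n / 2) := by
    exact_mod_cast two_pow_le_mul_choose_half n
  calc (G.card : ℝ) = ∑ B ∈ G, (1 : ℝ) := by simp
    _ ≤ ∑ B ∈ G, Real.exp (-(2 * m * t)) *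
      (Real.exp (t * (2 * B.card - n)) + Real.exp (-t * (2 * B.card - n))) := sum_le_sum hpt
    _ ≤ ∑ B : Finset (Fin n), Real.exp (-(2 * m * t)) *
      (Real.exp (t * (2 * B.card - n)) + Real.exp (-t * (2 * B.card - n))) :=
      sum_le_sum_of_subset_of_nonneg (subset_univ G) fun _ _ _ => by positivity
    _ = Real.exp (-(2 * m * t)) * (∑ B : Finset (Fin n), Real.exp (t * (2 * B.card - n)) +
        ∑ B : Finset (Fin n), Real.exp (-t * (2 * B.card - n))) := by
      rw [← mul_sum, sum_add_distrib]
    _ ≤ Real.exp (-(2 * m * t)) * (2 ^ n * Real.exp (n * (t ^ 2 / 2)) +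
        2 ^ n * Real.exp (n * ((-t) ^ 2 / 2))) := by
      gcongr
      · exact sum_exp_card t
      · exact sum_exp_card (-t)
    _ = 2 * 2 ^ n * Real.exp (-(2 * (m : ℝ) ^ 2 / n)) := by
      have : -(2 * (m : ℝ) ^ 2 / n) = -(2 * m * t) + n * (t ^ 2 / 2) := by
        rw [ht]; field_simp; ring
      rw [this, Real.exp_add, neg_sq]; ring
    _ ≤ 2 * ((n + 1) * n.choose (n / 2)) * Real.exp (-(2 * (m : ℝ) ^ 2 / n)) := by
      gcongr
    _ = _ := by ring

lemma card_le_lubell_mul {n : ℕ} (F : Finset (Finset (Fin n))) :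
    (F.card : ℝ) ≤ lubell F * n.choose (n / 2) := by
  rw [lubell, sum_mul, card_eq_sum_ones, Nat.cast_sum]
  refine sum_le_sum fun B _ => ?_
  have hB : B.card ≤ n := by simpa using card_le_univ B
  have h1 : (0 : ℝ) < (n.choose B.card : ℝ) := by exact_mod_cast Nat.choose_pos hB
  rw [Fintype.card_fin, inv_mul_eq_div, Nat.cast_one, one_le_div h1]
  exact_mod_cast Nat.choose_le_middle B.card n

/-- Allows every scale in the argument to be an exact power of the integer part q of the k-th root
of n. -/
lemma exists_pow_le_lt {n k P : ℕ} (hk : 0 < k) (hP : P ^ k ≤ n) :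
    ∃ q : ℕ, P ≤ q ∧ q ^ k ≤ n ∧ n < (q + 1) ^ k := by
  suffices h : ∃ q : ℕ, q ^ k ≤ n ∧ n < (q + 1) ^ k by
    obtain ⟨q, h1, h2⟩ := h
    refine ⟨q, ?_, h1, h2⟩
    by_contra! hcon
    exact absurd (Nat.pow_le_pow_left hcon k) (by rw [Nat.succ_eq_add_one]; omega)
  refine ⟨Nat.findGreatest (fun q => q ^ k ≤ n) n, ?_, ?_⟩
  · refine Nat.findGreatest_spec (P := fun q => q ^ k ≤ n) (m := 0) (Nat.zero_le n) ?_
    rw [zero_pow hk.ne']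
    exact Nat.zero_le n
  · by_contra! hcon
    have h1 : Nat.findGreatest (fun q => q ^ k ≤ n) n + 1 ≤ n :=
      (Nat.le_self_pow hk.ne' _).trans hcon
    exact Nat.findGreatest_is_greatest (P := fun q => q ^ k ≤ n) (Nat.lt_succ_self _) h1 hcon

/-- Here n is about x^40. The strip has half-width x^22, a little more than √n, windows have x^10
levels, the cutoff l is x^16 and N is x^39. Each window loses O(x^4), and about 2x^12 windows
together with l give H = O(x^16). As δ = O(x^(-17)), the error is O(1/x); the trivial H of order
x^22 would give x^5. -/
lemma error_term_le {x R : ℝ} (hx : 1 ≤ x) (hR1 : 1 ≤ R) (hR : R ^ 2 ≤ x) :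
    2 * (2 * x ^ 22 / x ^ 39) * (x ^ 16 + (2 * x ^ 12 + 1) *
      (R + (2 * x ^ 10 / x ^ 39 + x ^ 10 / x ^ 16) * (x ^ 10 + R ^ 2)) + R ^ 2) ≤ 92 / x := by
  have hx0 : 0 < x := by linarith
  have hp : ∀ {i j : ℕ}, i ≤ j → x ^ i ≤ x ^ j := fun h => pow_le_pow_right₀ hx h
  have h1 : 2 * x ^ 10 / x ^ 39 + x ^ 10 / x ^ 16 ≤ 3 / x ^ 6 := by
    have e1 : 2 * x ^ 10 / x ^ 39 = 2 / x ^ 29 := by field_simp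
    have e2 : x ^ 10 / x ^ 16 = 1 / x ^ 6 := by field_simp
    have e3 : 2 / x ^ 29 ≤ 2 / x ^ 6 :=
      div_le_div_of_nonneg_left (by norm_num) (by positivity) (hp (by norm_num))
    rw [e1, e2]
    calc 2 / x ^ 29 + 1 / x ^ 6 ≤ 2 / x ^ 6 + 1 / x ^ 6 := by linarith
      _ = 3 / x ^ 6 := by rw [← add_div]; norm_num
  have hx1 : ∀ {j : ℕ}, 1 ≤ j → x ≤ x ^ j := fun h => by simpa using hp h
  have h2 : x ^ 10 + R ^ 2 ≤ 2 * x ^ 10 := by linarith [hx1 (j := 10) (by norm_num)]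
  have h3 : (2 * x ^ 10 / x ^ 39 + x ^ 10 / x ^ 16) * (x ^ 10 + R ^ 2) ≤ 6 * x ^ 4 := by
    calc _ ≤ 3 / x ^ 6 * (2 * x ^ 10) := by gcongr
      _ = 6 * x ^ 4 := by field_simp; norm_num
  have h4 : R ≤ x ^ 4 := by nlinarith [hx1 (j := 4) (by norm_num)]
  have h5 : (2 * x ^ 12 + 1) *
      (R + (2 * x ^ 10 / x ^ 39 + x ^ 10 / x ^ 16) * (x ^ 10 + R ^ 2)) ≤ 21 * x ^ 16 := by
    have : 2 * x ^ 12 + 1 ≤ 3 * x ^ 12 := by linarith [one_le_pow₀ (n := 12) hx]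
    calc _ ≤ 3 * x ^ 12 * (7 * x ^ 4) := by
          gcongr
          linarith
      _ = 21 * x ^ 16 := by ring
  calc _ ≤ 2 * (2 * x ^ 22 / x ^ 39) * (23 * x ^ 16) := by
        gcongr
        linarith [hx1 (j := 16) (by norm_num)]
    _ = 92 / x := by field_simp; norm_num

/-- The exponent is at least x^4 / c, and exp y ≥ y^11 / 11! gives decay x^(-44), which beats the
factor n of order x^40. -/
lemma exp_tail_le {x n c : ℝ} (hx : 1 ≤ x) (hn : 1 ≤ n) (hc : 0 < c) (hnc : n ≤ c * x ^ 40) :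
    2 * (n + 1) * Real.exp (-(2 * (x ^ 22) ^ 2 / n)) ≤
      4 * c * (c ^ 11 * (Nat.factorial 11 : ℝ)) / x := by
  have hx0 : 0 < x := by linarith
  have hn0 : 0 < n := by linarith
  have hf : (0 : ℝ) < (Nat.factorial 11 : ℝ) := by exact_mod_cast Nat.factorial_pos 11
  set y : ℝ := 2 * (x ^ 22) ^ 2 / n with hy
  have hyge : x ^ 4 / c ≤ y := by
    rw [hy, div_le_div_iff₀ hc hn0]
    calc x ^ 4 * n ≤ x ^ 4 * (c * x ^ 40) := by gcongr
      _ = (x ^ 22) ^ 2 * c := by ring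
      _ ≤ 2 * (x ^ 22) ^ 2 * c := by
        have : 0 ≤ (x ^ 22) ^ 2 * c := by positivity
        linarith
  have hy0 : 0 < y := lt_of_lt_of_le (by positivity) hyge
  have h1 := Real.pow_div_factorial_le_exp y hy0.le 11
  generalize (Nat.factorial 11 : ℝ) = f at hf h1 ⊢
  have hexp : Real.exp (-y) ≤ f / (x ^ 4 / c) ^ 11 := by
    have h2 : (x ^ 4 / c) ^ 11 ≤ y ^ 11 := pow_le_pow_left₀ (by positivity) hyge 11
    rw [div_le_iff₀ hf] at h1
    rw [Real.exp_neg, inv_le_comm₀ (Real.exp_pos y) (by positivity), inv_div, div_le_iff₀ hf]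
    exact h2.trans h1
  calc 2 * (n + 1) * Real.exp (-y) ≤ 4 * (c * x ^ 40) * (f / (x ^ 4 / c) ^ 11) :=
        mul_le_mul (by linarith) hexp (Real.exp_pos _).le (by positivity)
    _ = 4 * c * (c ^ 11 * f) / x ^ 4 := by
      field_simp
    _ ≤ 4 * c * (c ^ 11 * f) / x := by
      refine div_le_div_of_nonneg_left (by positivity) hx0 ?_
      simpa using pow_le_pow_right₀ hx (by norm_num : 1 ≤ 4)

lemma exists_tail_bound : ∃ K : ℝ, ∀ q n : ℕ, 1 ≤ q → q ^ 40 ≤ n → n < (q + 1) ^ 40 →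
    2 * ((n : ℝ) + 1) * Real.exp (-(2 * ((q ^ 22 : ℕ) : ℝ) ^ 2 / n)) ≤ K / q := by
  refine ⟨4 * 2 ^ 40 * ((2 ^ 40) ^ 11 * (Nat.factorial 11 : ℝ)), fun q n hq hn hn' => ?_⟩
  have hn1 : 1 ≤ n := le_trans (Nat.one_le_pow _ _ hq) hn
  rw [Nat.cast_pow]
  refine exp_tail_le (c := 2 ^ 40) (by exact_mod_cast hq) (by exact_mod_cast hn1) (by positivity) ?_
  have h1 : (q + 1) ^ 40 ≤ (2 * q) ^ 40 := Nat.pow_le_pow_left (by omega) 40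
  rw [mul_pow] at h1
  exact_mod_cast hn'.le.trans h1

lemma card_le_of_not_hasCrown {n q R : ℕ} {K : ℝ} (hK : ∀ q n : ℕ, 1 ≤ q → q ^ 40 ≤ n →
    n < (q + 1) ^ 40 →
    2 * ((n : ℝ) + 1) * Real.exp (-(2 * ((q ^ 22 : ℕ) : ℝ) ^ 2 / n)) ≤ K / q)
    (hq : 8 ≤ q) (hR1 : 1 ≤ R) (hR : R ^ 2 ≤ q)
    (hn : q ^ 40 ≤ n) (hn' : n < (q + 1) ^ 40) (F : Finset (Finset (Fin n)))
    (hF : ¬ HasCrown R F) :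
    (F.card : ℝ) ≤ (R + (92 / q + K / q)) * n.choose (n / 2) := by
  have hx : (1 : ℝ) ≤ q := by exact_mod_cast (by omega : 1 ≤ q)
  have p1 : 8 * q ^ 39 ≤ q ^ 40 := by rw [pow_succ' q 39]; exact Nat.mul_le_mul_right _ hq
  have p2 : 64 * q ^ 22 ≤ q ^ 39 := by
    calc 64 * q ^ 22 = 8 ^ 2 * q ^ 22 := by norm_num
      _ ≤ q ^ 2 * q ^ 22 := Nat.mul_le_mul_right _ (Nat.pow_le_pow_left hq 2)
      _ = q ^ 24 := by rw [← pow_add]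
      _ ≤ q ^ 39 := Nat.pow_le_pow_right (by omega) (by norm_num)
  have p3 : q ^ 16 ≤ q ^ 22 := Nat.pow_le_pow_right (by omega) (by norm_num)
  have p4 : q ^ 10 ≤ q ^ 22 := Nat.pow_le_pow_right (by omega) (by norm_num)
  have p5 : 1 ≤ q ^ 10 := Nat.one_le_pow _ _ (by omega)
  have p6 : 1 ≤ q ^ 16 := Nat.one_le_pow _ _ (by omega)
  have p7 : 1 ≤ q ^ 22 := Nat.one_le_pow _ _ (by omega)
  set G := F.filter fun B => n / 2 - q ^ 22 ≤ B.card ∧ B.card ≤ n / 2 + q ^ 22 with hG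
  set G' := F.filter fun B => ¬ (n / 2 - q ^ 22 ≤ B.card ∧ B.card ≤ n / 2 + q ^ 22) with hG'
  have hcard : (F.card : ℝ) = G.card + G'.card := by
    exact_mod_cast (card_filter_add_card_filter_not _).symm
  have hdiff : n / 2 + q ^ 22 - (n / 2 - q ^ 22) = 2 * q ^ 22 := by omega
  have hdiv : 2 * q ^ 22 / q ^ 10 = 2 * q ^ 12 := by
    rw [show 2 * q ^ 22 = 2 * q ^ 12 * q ^ 10 by ring]
    exact Nat.mul_div_cancel _ p5
  have hlub := lubell_middle_le (F := G) (lo := n / 2 - q ^ 22) (hi := n / 2 + q ^ 22) (r := R)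
    (w := q ^ 10) (l := q ^ 16) (N := q ^ 39) hR1 (fun B hB => (mem_filter.1 hB).2) (by omega)
    p5 p6 (by omega) (by omega) (by rw [Fintype.card_fin]; omega)
    (fun h => hF (h.mono (filter_subset _ _)))
  rw [hdiff, hdiv] at hlub
  push_cast at hlub
  have herr := error_term_le hx (R := R) (by exact_mod_cast hR1) (by exact_mod_cast hR)
  have hmid : (G.card : ℝ) ≤ (R + 92 / q) * n.choose (n / 2) :=
    (card_le_lubell_mul G).trans
      (mul_le_mul_of_nonneg_right (by linarith) (choose_half_pos n).le)
  have hfar : (G'.card : ℝ) ≤ K / q * n.choose (n / 2) := by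
    refine (card_far_le (m := q ^ 22) (by omega) G' ?_).trans
      (mul_le_mul_of_nonneg_right (hK q n (by omega) hn hn') (choose_half_pos n).le)
    intro B hB
    have := (mem_filter.1 hB).2
    omega
  rw [hcard]
  calc (G.card : ℝ) + G'.card ≤ _ := add_le_add hmid hfar
    _ = _ := by ring

/-- A family without crowns of size `R` has size at most `(R + o(1))` times the middle binomial
coefficient. -/
theorem eventually_card_le {R : ℕ} (hR : 1 ≤ R) {ε : ℝ} (hε : 0 < ε) :
    ∀ᶠ n : ℕ in atTop, ∀ F : Finset (Finset (Fin n)), ¬ HasCrown R F →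
      (F.card : ℝ) ≤ (R + ε) * n.choose (n / 2) := by
  obtain ⟨K, hK⟩ := exists_tail_bound
  obtain ⟨Q, hQ⟩ := exists_nat_gt ((92 + K) / ε)
  obtain ⟨P, hP1, hP2, hP3⟩ : ∃ P, Q ≤ P ∧ 8 ≤ P ∧ R ^ 2 ≤ P :=
    ⟨max Q (max 8 (R ^ 2)), by simp, by simp, by simp⟩
  refine (eventually_ge_atTop (P ^ 40)).mono fun n hn F hF => ?_
  obtain ⟨q, hq, hq1, hq2⟩ := exists_pow_le_lt (by norm_num) hn
  refine (card_le_of_not_hasCrown hK (q := q) (hP2.trans hq) hR (hP3.trans hq) hq1 hq2 F hF).trans ?_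
  refine mul_le_mul_of_nonneg_right (add_le_add le_rfl ?_) (choose_half_pos n).le
  have hq0 : (0 : ℝ) < q := by exact_mod_cast lt_of_lt_of_le (by norm_num) (hP2.trans hq)
  have hQq : (Q : ℝ) ≤ q := by exact_mod_cast hP1.trans hq
  rw [← add_div, div_le_iff₀ hq0]
  rw [div_lt_iff₀ hε, mul_comm] at hQ
  exact hQ.le.trans (mul_le_mul_of_nonneg_left hQq hε.le)

end Asymptotics

/-! ### Standard examples -/

section StandardExamples

open Finset Filter Topology

/-- `HasCrown` alone allows a_i ⊆ b_j. A spare index e outside the first r excludes it: b_e ⊆ a_i ⊆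
b_j would make two different b's comparable. So the first r pairs form an induced copy. -/
lemma not_hasCrown_of_posetFree {r n : ℕ} {F : Finset (Finset (Fin n))}
    (hF : PosetFree (StandardExample r) F) : ¬ HasCrown (r + 2) F := by
  rintro ⟨a, b, ha, hb, hab⟩
  have haa : ∀ i j, a i ⊆ a j ↔ i = j := by
    refine fun i j => ⟨fun h => ?_, fun h => h ▸ Subset.rfl⟩
    by_contra hij
    exact (hab j j).1 (((hab i j).2 hij).trans h) rfl
  have hbb : ∀ i j, b i ⊆ b j ↔ i = j := by
    refine fun i j => ⟨fun h => ?_, fun h => h ▸ Subset.rfl⟩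
    by_contra hij
    exact (hab i i).1 (h.trans ((hab i j).2 hij)) rfl
  have hnot : ∀ i j : Fin r, ¬ a (i.castAdd 2) ⊆ b (j.castAdd 2) := by
    intro i j h
    have h1 : i.castAdd 2 ≠ Fin.natAdd r (0 : Fin 2) := by
      intro h; have := congrArg Fin.val h; simp at this; omega
    have h2 : Fin.natAdd r (0 : Fin 2) ≠ j.castAdd 2 := by
      intro h; have := congrArg Fin.val h; simp at this; omega
    exact h2 ((hbb _ _).1 (((hab _ _).2 h1).trans h))
  have hinj : ∀ i j : Fin r, i.castAdd 2 = j.castAdd 2 ↔ i = j := fun i j => by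
    simp [Fin.ext_iff]
  refine hF ⟨OrderEmbedding.ofMapLEIff
    (fun x => match x with
      | .a i => ⟨a (i.castAdd 2), ha _⟩
      | .b i => ⟨b (i.castAdd 2), hb _⟩) ?_⟩
  rintro (i | i) (j | j)
  · exact (haa _ _).trans (hinj i j)
  · exact iff_of_false (hnot i j) id
  · exact (hab _ _).trans (not_congr (hinj j i))
  · exact (hbb _ _).trans (hinj i j)

lemma turanFunction_le {n r : ℕ} {c : ℝ} (hc : 0 ≤ c)
    (h : ∀ F : Finset (Finset (Fin n)), PosetFree (StandardExample r) F → (F.card : ℝ) ≤ c) :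
    (turanFunction n (StandardExample r) : ℝ) ≤ c := by
  classical
  have : turanFunction n (StandardExample r) ≤ ⌊c⌋₊ :=
    Finset.sup_le fun F hF => Nat.le_floor (h F (mem_filter.1 hF).2)
  exact (Nat.cast_le.2 this).trans (Nat.floor_le hc)

lemma le_turanFunction {n r : ℕ} {F : Finset (Finset (Fin n))}
    (hF : PosetFree (StandardExample r) F) : F.card ≤ turanFunction n (StandardExample r) := by
  classical
  exact Finset.le_sup (f := Finset.card) (mem_filter.2 ⟨mem_univ F, hF⟩)

/-- In a copy of the standard example, some two members differ in size by at least `r - 2`. -/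
lemma posetFree_of_card_lt {r n s : ℕ} (hr : 1 ≤ r) {F : Finset (Finset (Fin n))}
    (hF : ∀ B ∈ F, s ≤ B.card ∧ B.card < s + (r - 2)) : PosetFree (StandardExample r) F := by
  rintro ⟨f⟩
  -- For r ≤ 2 the truncated r - 2 is zero and F has no members, so the existence of a member gives
  -- r ≥ 3.
  have hsize := hF _ (f (.a ⟨0, hr⟩)).2
  have hr3 : 3 ≤ r := by omega
  have hba : ∀ i j, (f (.b j)).1 ⊆ (f (.a i)).1 ↔ i ≠ j :=
    fun i j => f.le_iff_le (a := .b j) (b := .a i)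
  have hx : ∀ i, ∃ x, x ∈ (f (.b i)).1 ∧ x ∉ (f (.a i)).1 := fun i =>
    not_subset.1 fun h => (hba i i).1 h rfl
  choose x hxb hxa using hx
  have hinj : Function.Injective x := by
    intro i j hij
    by_contra hne
    exact hxa j (hij ▸ (hba j i).2 (Ne.symm hne) (hxb i))
  -- The x_i with i ≠ i₀, i₁ are r - 2 distinct elements of a_{i₀}. None lies in b_{i₁}, since
  -- b_{i₁} ⊆ a_i, while b_{i₁} ⊆ a_{i₀}; this is the gap in size.
  let i₀ : Fin r := ⟨0, by omega⟩
  let i₁ : Fin r := ⟨1, by omega⟩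
  have h01 : i₀ ≠ i₁ := by simp [i₀, i₁]
  let I : Finset (Fin r) := (univ.erase i₀).erase i₁
  have hI : I.card = r - 2 := by
    rw [card_erase_of_mem (by simp [h01.symm]), card_erase_of_mem (mem_univ _), card_univ,
      Fintype.card_fin]
    omega
  have hdisj : Disjoint (f (.b i₁)).1 (I.image x) := by
    rw [disjoint_left]
    rintro y hy hyI
    obtain ⟨i, hi, rfl⟩ := mem_image.1 hyI
    exact hxa i ((hba i i₁).2 (ne_of_mem_erase hi) hy)
  have hsub : (f (.b i₁)).1 ∪ I.image x ⊆ (f (.a i₀)).1 := by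
    refine union_subset ((hba i₀ i₁).2 h01) fun y hyI => ?_
    obtain ⟨i, hi, rfl⟩ := mem_image.1 hyI
    exact (hba i₀ i).2 (ne_of_mem_erase (mem_of_mem_erase hi)).symm (hxb i)
  have hcard := card_le_card hsub
  rw [card_union_of_disjoint hdisj, card_image_of_injective _ hinj, hI] at hcard
  have h1 := hF _ (f (.b i₁)).2
  have h2 := hF _ (f (.a i₀)).2
  omega

/-- For fixed j, the ratio of consecutive binomial coefficients near the middle, (n - k)/(k + 1)
with k = ⌊n/2⌋ + j, tends to 1. -/
lemma tendsto_choose_half_add_div (j : ℕ) :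
    Tendsto (fun n : ℕ => (n.choose (n / 2 + j) : ℝ) / n.choose (n / 2)) atTop (𝓝 1) := by
  induction j with
  | zero =>
    refine tendsto_const_nhds.congr fun n => ?_
    rw [add_zero, div_self (choose_half_pos n).ne']
  | succ j ih =>
    have hhalf : Tendsto (fun n : ℕ => ((n / 2 : ℕ) : ℝ)) atTop atTop :=
      tendsto_natCast_atTop_atTop.comp (Nat.tendsto_div_const_atTop (by norm_num))
    have hlow : Tendsto (fun n : ℕ => 1 - (2 * (j : ℝ) + 1) / (n / 2 : ℕ)) atTop (𝓝 1) := by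
      simpa using (tendsto_const_nhds (x := (1 : ℝ))).sub (hhalf.const_div_atTop (2 * (j : ℝ) + 1))
    have hratio : Tendsto (fun n : ℕ => ((n : ℝ) - (n / 2 + j : ℕ)) / ((n / 2 + j : ℕ) + 1))
        atTop (𝓝 1) := by
      refine tendsto_of_tendsto_of_tendsto_of_le_of_le' hlow tendsto_const_nhds ?_ ?_
      · filter_upwards [eventually_ge_atTop 2] with n hn
        have h1 : (0 : ℝ) < (n / 2 : ℕ) := by exact_mod_cast (by omega : 0 < n / 2)
        have h2 : 2 * ((n / 2 : ℕ) : ℝ) ≤ n := by exact_mod_cast (by omega : 2 * (n / 2) ≤ n)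
        push_cast
        set h : ℝ := ((n / 2 : ℕ) : ℝ)
        have hj : (0 : ℝ) ≤ j := by positivity
        have e1 : 1 - (2 * (j : ℝ) + 1) / h ≤ 1 - (2 * (j : ℝ) + 1) / (h + j + 1) := by
          have : (2 * (j : ℝ) + 1) / (h + j + 1) ≤ (2 * (j : ℝ) + 1) / h :=
            div_le_div_of_nonneg_left (by positivity) h1 (by linarith)
          linarith
        refine e1.trans ?_
        rw [one_sub_div (by positivity)]
        exact div_le_div_of_nonneg_right (by linarith) (by positivity)
      · filter_upwards with n
        have h2 : (n : ℝ) ≤ 2 * ((n / 2 : ℕ) : ℝ) + 1 := by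
          exact_mod_cast (by omega : n ≤ 2 * (n / 2) + 1)
        push_cast
        have hj : (0 : ℝ) ≤ j := by positivity
        rw [div_le_one (by positivity)]
        linarith
    have hmul := ih.mul hratio
    rw [one_mul] at hmul
    refine hmul.congr' ?_
    filter_upwards [eventually_ge_atTop (2 * j)] with n hn
    have h := Nat.choose_succ_right_eq n (n / 2 + j)
    have h' : (n.choose (n / 2 + j + 1) : ℝ) * ((n / 2 + j : ℕ) + 1) =
        n.choose (n / 2 + j) * ((n : ℝ) - (n / 2 + j : ℕ)) := by
      rw [← Nat.cast_sub (by omega)]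
      exact_mod_cast h
    have hpos := choose_half_pos n
    have hpos' : (0 : ℝ) < ((n / 2 + j : ℕ) : ℝ) + 1 := by positivity
    rw [← add_assoc, div_mul_div_comm, div_eq_div_iff (by positivity) hpos.ne', ← h']
    ring

/-- Witnessed by the r - 2 full levels starting at ⌊n/2⌋, each asymptotically as large as the middle
one. -/
lemma eventually_turanFunction_ge {r : ℕ} (hr : 1 ≤ r) {ε : ℝ} (hε : 0 < ε) :
    ∀ᶠ n : ℕ in atTop, ((r : ℝ) - 2 - ε) * n.choose (n / 2) ≤
      turanFunction n (StandardExample r) := by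
  have hsum : Tendsto (fun n : ℕ => ∑ j ∈ range (r - 2),
      (n.choose (n / 2 + j) : ℝ) / n.choose (n / 2)) atTop (𝓝 ((r - 2 : ℕ) : ℝ)) := by
    simpa using tendsto_finsetSum (range (r - 2)) fun j _ => tendsto_choose_half_add_div j
  have hlt : (r : ℝ) - 2 - ε < ((r - 2 : ℕ) : ℝ) := by
    have : r ≤ (r - 2) + 2 := by omega
    have : (r : ℝ) ≤ ((r - 2 : ℕ) : ℝ) + 2 := by exact_mod_cast this
    linarith
  filter_upwards [hsum.eventually_const_lt hlt] with n hn
  rw [← sum_div, lt_div_iff₀ (choose_half_pos n)] at hn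
  refine hn.le.trans ?_
  set F : Finset (Finset (Fin n)) := (range (r - 2)).biUnion fun j =>
    powersetCard (n / 2 + j) univ
  have hF : PosetFree (StandardExample r) F := by
    refine posetFree_of_card_lt (s := n / 2) hr fun B hB => ?_
    obtain ⟨j, hj, hB⟩ := mem_biUnion.1 hB
    rw [mem_range] at hj
    rw [(mem_powersetCard.1 hB).2]
    omega
  have hcard : F.card = ∑ j ∈ range (r - 2), n.choose (n / 2 + j) := by
    rw [card_biUnion]
    · simp
    · intro i _ j _ hij
      refine disjoint_left.2 fun B hB hB' => ?_
      have h1 := (mem_powersetCard.1 hB).2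
      have h2 := (mem_powersetCard.1 hB').2
      omega
  have := le_turanFunction hF
  rw [hcard] at this
  exact_mod_cast this

lemma eventually_turanFunction_le (r : ℕ) {ε : ℝ} (hε : 0 < ε) :
    ∀ᶠ n : ℕ in atTop, (turanFunction n (StandardExample r) : ℝ) ≤
      ((r : ℝ) + 2 + ε) * n.choose (n / 2) := by
  filter_upwards [eventually_card_le (R := r + 2) (by omega) hε] with n hn
  refine turanFunction_le (by positivity) fun F hF => ?_
  have := hn F (not_hasCrown_of_posetFree hF)
  push_cast at this
  exact this

end StandardExamples

theorem mainTheorem2 :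
    (∀ r : ℕ, 1 ≤ r →
      (((r : ℝ) - 2 : ℝ) : EReal) ≤ turanThreshold (StandardExample r) ∧
      turanThreshold (StandardExample r) ≤ (((r : ℝ) + 2 * √(r : ℝ) + 6 : ℝ) : EReal)) ∧
    (∃ C : ℝ, ∀ r : ℕ, 1 ≤ r → ∀ᶠ n : ℕ in Filter.atTop,
      |(turanFunction n (StandardExample r) : ℝ) - (r : ℝ) * (n.choose (n / 2) : ℝ)|
        ≤ C * √(r : ℝ) * (n.choose (n / 2) : ℝ)) := by
  -- With ε = 1 the deviation from r is at most 3 on either side, and √r ≥ 1, so C = 3 works.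
  refine ⟨fun r hr => ⟨?_, ?_⟩, 3, fun r hr => ?_⟩
  · refine le_of_forall_lt fun c hc => ?_
    obtain ⟨x, hcx, hx⟩ := EReal.lt_iff_exists_real_btwn.1 hc
    refine hcx.trans_le (Filter.le_limsup_of_frequently_le (Filter.Eventually.frequently ?_))
    have hx' : x < (r : ℝ) - 2 := EReal.coe_lt_coe_iff.1 hx
    filter_upwards [eventually_turanFunction_ge hr (sub_pos.2 hx')] with n hn
    rw [EReal.coe_le_coe_iff, le_div_iff₀ (choose_half_pos n)]
    simpa using hn
  · refine Filter.limsup_le_of_le (by isBoundedDefault) ?_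
    filter_upwards [eventually_turanFunction_le r one_pos] with n hn
    rw [EReal.coe_le_coe_iff, div_le_iff₀ (choose_half_pos n)]
    refine hn.trans (mul_le_mul_of_nonneg_right ?_ (choose_half_pos n).le)
    linarith [Real.sqrt_nonneg (r : ℝ)]
  · filter_upwards [eventually_turanFunction_le r one_pos, eventually_turanFunction_ge hr one_pos]
      with n h1 h2
    have hs : (1 : ℝ) ≤ √(r : ℝ) := Real.one_le_sqrt.2 (by exact_mod_cast hr)
    have h3 : (n.choose (n / 2) : ℝ) ≤ √(r : ℝ) * n.choose (n / 2) :=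
      le_mul_of_one_le_left (choose_half_pos n).le hs
    rw [abs_le]
    constructor <;> linarith
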